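/- Conventions. The second coordinate of a point of the plane is its height. A bounded open set $S\subset\mathbb R^2$ (not necessarily connected, nonempty, equal to the interior of its closure) whose boundary $\partial S$ is a disjoint union of finitely many simple closed polygons is called a domain. An arc is a broken line without self-intersection with two distinct ends. It is a crossing (type $C$) if the ends of its height range are the heights of its two ends; it has type $B$ (resp. $D$) if both its ends have the same height $h$ and it lies in the half-plane of heights $\ge h$ (resp. $\le h$). A number $c$ is a critical height of $\partial S$ if some subarc of $\partial S$ attains its maximal or its minimal height at the value $c$ while none of its ends has height $c$. For $h<H$, the band $[h,H]$ (the set of points of height between $h$ and $H$) is unicritical if $h,H$ are not critical and $[h,H]$ contains at most one critical height. The crossing components of a band are the maximal crossing subarcs of the part $\partial S[h,H]$ of $\partial S$ in the band. The lower (upper) position of a crossing component is the number of crossing components whose end on the level $h$ (resp. $H$) lies to the left of its end on that level, and is $0$ if it has no end there. In a unicritical band, of two disjoint crossing components the left one is the one whose intersection with the critical level (with any inner level, if there is no critical one) lies to the left; of two distinct intersecting ones, whose union is then an arc of type $B$ or $D$, the left one is the one with the smaller lower position for type $B$, and with the smaller upper position for type $D$. The position of a crossing component is the number of crossing components on its left.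 The string of a unicritical band lists the crossing components by increasing position and writes for each of them the type ($B$, $C$ or $D$) of the connected component of $\partial S[h,H]$ that contains it. If $h_0>h_1>\dots>h_m$ are such that $S$ lies in the band $[h_m,h_0]$ and all bands $[h_{k},h_{k-1}]$ are unicritical, then the strings of the bands $[h_1,h_0],[h_2,h_1],\dots,[h_m,h_{m-1}]$, in this order and separated by the symbol $;$, form a CRIPT-code of $S$. A word over $\{B,C,D,;\}$ is correct if it is a CRIPT-code of some domain, for some such choice of levels. For a word $w$, let $w[1],\dots,w[n]$ be its (possibly empty) strings, i.e. the blocks between consecutive separators, and let $B(v),C(v),D(v)$ denote the numbers of letters $B,C,D$ in $v$. Theorem. Let $w$ be a word over the alphabet $\{B,C,D,;\}$ such that 1. (boundary conditions) $B(w[1])>0$ and $C(w[1])=D(w[1])=0$; $D(w[n])>0$ and $B(w[n])=C(w[n])=0$; 2. (evenness conditions) for each $T\in\{B,D\}$: whenever an occurrence of $T$ in $w$ is preceded in $w$ by an even number of letters $T$, it is not the last symbol of $w$ and the next symbol of $w$ is again $T$; 3. (balance conditions) $B(w[k])+C(w[k])=D(w[k+1])+C(w[k+1])$ for every $1\le k<n$.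 Then $w$ is correct: there are a domain $S$ and levels $h_0>\dots>h_m$ as above such that the corresponding CRIPT-code of $S$ is $w$. -/

import Mathlib

namespace Cript

/-! ### Words of the alphabet `{B, C, D, ;}` -/

/-- The alphabet; `sep` is the separator `;`. -/
inductive Symbol where
  | B
  | C
  | D
  | sep
  deriving DecidableEq

/-- The strings of a word: the maximal blocks between separators (blocks may be empty). -/
def strings (w : List Symbol) : List (List Symbol) := w.splitOn Symbol.sep

/-- The `k`-th string of a word, counted from `0` (empty if there is no such string). -/
def stringAt (w : List Symbol) (k : ℕ) : List Symbol := (strings w).getD k []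

/-- The number of strings, i.e. the number of separators plus one. -/
def numStrings (w : List Symbol) : ℕ := (strings w).length

/-- The first string is a nonempty string of `B`s, the last one a nonempty string of `D`s. -/
def BoundaryConditions (w : List Symbol) : Prop :=
  (0 < (stringAt w 0).count Symbol.B ∧
    (stringAt w 0).count Symbol.C = 0 ∧
    (stringAt w 0).count Symbol.D = 0) ∧
  (0 < (stringAt w (numStrings w - 1)).count Symbol.D ∧
    (stringAt w (numStrings w - 1)).count Symbol.C = 0 ∧
    (stringAt w (numStrings w - 1)).count Symbol.B = 0)

/-- If a letter `t` of `w` is preceded in `w` by an even number of letters `t`, then the next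
symbol of `w` exists and is again `t`. -/
def EvennessFor (t : Symbol) (w : List Symbol) : Prop :=
  ∀ i : ℕ, w[i]? = some t → Even ((w.take i).count t) → w[i + 1]? = some t

def EvennessConditions (w : List Symbol) : Prop :=
  EvennessFor Symbol.B w ∧ EvennessFor Symbol.D w

def BalanceConditions (w : List Symbol) : Prop :=
  ∀ k : ℕ, k + 1 < numStrings w →
    (stringAt w k).count Symbol.B + (stringAt w k).count Symbol.C =
      (stringAt w (k + 1)).count Symbol.D + (stringAt w (k + 1)).count Symbol.C

/-! ### Arcs and their height types -/

/-- The plane; the second coordinate is the height. -/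
abbrev Plane : Type := ℝ × ℝ

/-- `A` is a (nonclosed) arc with ends `p` and `q`. Inside a piecewise linear set these are
exactly the broken lines without self-intersection. -/
def IsArc (A : Set Plane) (p q : Plane) : Prop :=
  ∃ γ : ℝ → Plane, ContinuousOn γ (Set.Icc 0 1) ∧ Set.InjOn γ (Set.Icc 0 1) ∧
    γ '' Set.Icc 0 1 = A ∧ γ 0 = p ∧ γ 1 = q

/-- `p` is an end of the arc `A`. -/
def IsEnd (A : Set Plane) (p : Plane) : Prop := ∃ q, IsArc A p q

/-- The ends of the height range of the arc are the heights of its ends. -/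
def IsCrossing (A : Set Plane) : Prop :=
  ∃ p q, IsArc A p q ∧ ∀ x ∈ A, p.2 ≤ x.2 ∧ x.2 ≤ q.2

/-- Type `B`: both ends lie on one level and the arc lies in the upper semiplane of it. -/
def IsBirth (A : Set Plane) : Prop :=
  ∃ p q, IsArc A p q ∧ p.2 = q.2 ∧ ∀ x ∈ A, p.2 ≤ x.2

/-- Type `D`: both ends lie on one level and the arc lies in the lower semiplane of it. -/
def IsDeath (A : Set Plane) : Prop :=
  ∃ p q, IsArc A p q ∧ p.2 = q.2 ∧ ∀ x ∈ A, x.2 ≤ p.2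

/-- The height type of an arc. -/
def HasType (A : Set Plane) : Symbol → Prop
  | Symbol.B => IsBirth A
  | Symbol.C => IsCrossing A
  | Symbol.D => IsDeath A
  | Symbol.sep => False

/-- The arc `A` touches the level `c`: the number `c` is an end of its height range, but not the
height of one of its ends. -/
def Touches (A : Set Plane) (c : ℝ) : Prop :=
  ∃ p q, IsArc A p q ∧ p.2 ≠ c ∧ q.2 ≠ c ∧ (∃ x ∈ A, x.2 = c) ∧
    ((∀ x ∈ A, c ≤ x.2) ∨ (∀ x ∈ A, x.2 ≤ c))

/-- `c` is a critical height of the curve `K`: some subarc of `K` touches the level `c`. -/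
def IsCritical (K : Set Plane) (c : ℝ) : Prop := ∃ A, A ⊆ K ∧ Touches A c

/-! ### Domains with piecewise linear boundary -/

/-- `K` is a disjoint union of finitely many simple closed polygons: a finite union of
nondegenerate segments that meet only in common endpoints, each endpoint belonging to exactly
two of the segments. -/
def IsPolygonalCurve (K : Set Plane) : Prop :=
  ∃ E : Set (Plane × Plane), E.Finite ∧
    K = ⋃ e ∈ E, segment ℝ e.1 e.2 ∧
    (∀ e ∈ E, e.1 ≠ e.2) ∧
    (∀ e ∈ E, ∀ f ∈ E, e ≠ f →
      segment ℝ e.1 e.2 ∩ segment ℝ f.1 f.2 ⊆ {e.1, e.2} ∩ {f.1, f.2}) ∧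
    (∀ e ∈ E, ∀ v : Plane, v = e.1 ∨ v = e.2 →
      {f | f ∈ E ∧ (v = f.1 ∨ v = f.2)}.ncard = 2)

/-- A bounded plane domain, not necessarily connected, whose boundary is a disjoint union of
finitely many simple closed polygons. The condition `interior (closure S) = S` says that near its
boundary the domain lies on one side only. It has finitely many connected components, because
its boundary is a finite union of segments. -/
structure IsPlaneDomain (S : Set Plane) : Prop where
  nonempty : S.Nonempty
  isOpen : IsOpen S
  isBounded : Bornology.IsBounded S
  regular : interior (closure S) = S
  boundary : IsPolygonalCurve (frontier S)

/-- The part of the boundary of `S` in the horizontal band between the levels `h` and `H`. -/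
def bandBoundary (S : Set Plane) (h H : ℝ) : Set Plane :=
  {p | p ∈ frontier S ∧ h ≤ p.2 ∧ p.2 ≤ H}

/-- The band `[h, H]` is regular (`h` and `H` are not critical) and contains at most one critical
height of the boundary of `S`. -/
def IsUnicritical (S : Set Plane) (h H : ℝ) : Prop :=
  h < H ∧ ¬ IsCritical (frontier S) h ∧ ¬ IsCritical (frontier S) H ∧
    {c | c ∈ Set.Icc h H ∧ IsCritical (frontier S) c}.Subsingleton

/-- Crossing components of the boundary of `S` in the band: the maximal crossing subarcs. -/
def IsCrossingComponent (S : Set Plane) (h H : ℝ) (A : Set Plane) : Prop :=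
  A ⊆ bandBoundary S h H ∧ IsCrossing A ∧
    ∀ A', A ⊆ A' → A' ⊆ bandBoundary S h H → IsCrossing A' → A' = A

/-- The number of crossing components of the band that have an end on the level `c` lying to the
left of an end of `A` on the level `c` (so it is `0` if `A` has no end on that level). For
`c = h` this is the lower position, for `c = H` the upper position of `A`. -/
noncomputable def endPosition (S : Set Plane) (h H c : ℝ) (A : Set Plane) : ℕ :=
  {A' | IsCrossingComponent S h H A' ∧
    ∃ p q, IsEnd A p ∧ p.2 = c ∧ IsEnd A' q ∧ q.2 = c ∧ q.1 < p.1}.ncard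

noncomputable def lowerPosition (S : Set Plane) (h H : ℝ) (A : Set Plane) : ℕ :=
  endPosition S h H h A

noncomputable def upperPosition (S : Set Plane) (h H : ℝ) (A : Set Plane) : ℕ :=
  endPosition S h H H A

/-- The crossing component `A₁` is on the left from `A₂`; here `g` is the critical level of the
band. Disjoint components are compared on the level `g`; intersecting ones form together an arc
of type `B` or `D` and are compared by lower, respectively upper, position. -/
def LeftOf (S : Set Plane) (h H g : ℝ) (A₁ A₂ : Set Plane) : Prop :=
  (Disjoint A₁ A₂ ∧ ∀ p ∈ A₁, ∀ q ∈ A₂, p.2 = g → q.2 = g → p.1 < q.1) ∨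
  (¬ Disjoint A₁ A₂ ∧ IsBirth (A₁ ∪ A₂) ∧ lowerPosition S h H A₁ < lowerPosition S h H A₂) ∨
  (¬ Disjoint A₁ A₂ ∧ IsDeath (A₁ ∪ A₂) ∧ upperPosition S h H A₁ < upperPosition S h H A₂)

/-- The position of a crossing component: the number of crossing components on its left. -/
noncomputable def position (S : Set Plane) (h H g : ℝ) (A : Set Plane) : ℕ :=
  {A' | IsCrossingComponent S h H A' ∧ LeftOf S h H g A' A}.ncard

/-- The connected component of the boundary part in the band that contains `A` has type `t`. -/
def HasComponentType (S : Set Plane) (h H : ℝ) (A : Set Plane) (t : Symbol) : Prop :=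
  ∃ x ∈ A, HasType (connectedComponentIn (bandBoundary S h H) x) t

/-- `u` is the string of the unicritical band `[h, H]`: the types of all crossing components,
listed by increasing position. The level `g` is the critical level of the band if there is one;
in an uncritical band it is any inner level (all of them give the same order). -/
def IsCriptString (S : Set Plane) (h H : ℝ) (u : List Symbol) : Prop :=
  IsUnicritical S h H ∧
  ∃ g ∈ Set.Ioo h H, (∀ c ∈ Set.Icc h H, IsCritical (frontier S) c → c = g) ∧
    ∃ l : List (Set Plane),
      (∀ A, A ∈ l ↔ IsCrossingComponent S h H A) ∧
      l.Pairwise (fun A₁ A₂ => position S h H g A₁ < position S h H g A₂) ∧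
      List.Forall₂ (HasComponentType S h H) l u

/-- The levels `h 0 > h 1 > ⋯ > h m` form a unicritical decomposition of `S`. -/
def IsUnicriticalDecomposition (S : Set Plane) {m : ℕ} (h : Fin (m + 1) → ℝ) : Prop :=
  StrictAnti h ∧ (∀ p ∈ S, h (Fin.last m) ≤ p.2 ∧ p.2 ≤ h 0) ∧
    ∀ k : Fin m, IsUnicritical S (h k.succ) (h k.castSucc)

/-- `w` is the code of `S` with respect to some unicritical decomposition: the strings of the
bands, in the order of decreasing level, separated by `;`. -/
def IsCriptCode (S : Set Plane) (w : List Symbol) : Prop :=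
  ∃ (m : ℕ) (h : Fin (m + 1) → ℝ) (s : Fin m → List Symbol),
    IsUnicriticalDecomposition S h ∧
    (∀ k : Fin m, IsCriptString S (h k.succ) (h k.castSucc) (s k)) ∧
    w = [Symbol.sep].intercalate (List.ofFn s)

/-- A word is correct if it is the code of some domain. -/
def IsCorrect (w : List Symbol) : Prop :=
  ∃ S : Set Plane, IsPlaneDomain S ∧ IsCriptCode S w

end Cript

/-!
Draw the string of each band as two layers of straight strands, one below and one above a critical
level in the middle of the band. A strand starts on the boundary of the band at its rank among the
strands that reach this boundary. On the critical level the two strands of a pair `BB` or `DD` end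
at a common point, and evenness says precisely that all letters `B`, and all letters `D`, come in
such adjacent pairs; a letter `C` gives one strand from below and one from above. Balance makes the
ranks match on the common level of two neighbouring bands. So two strand ends meet at every vertex,
and the drawing is a disjoint union of polygons.

The points with an odd number of strands on their left form a domain whose boundary is the whole
drawing, since this parity changes across every strand. In each band the crossing components are
the strands belonging to the single letters, and their position is their index from left to right,
so the string of the band is the one that was drawn.
-/

namespace Cript

open Set Filter Topology
open scoped Finset

/-! ### Layered drawings -/

/-- A plane drawing in horizontal layers: in the layer `[t, t + 1]` every strand `i ∈ strands t` is
the segment from `(bot t i, t)` to `(top t i, t + 1)`. Strands of a layer are ordered and meet only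
at the ends, and at each vertex exactly two strand ends meet. -/
structure LayeredDrawing where
  strands : ℤ → Finset ℕ
  bot : ℤ → ℕ → ℝ
  top : ℤ → ℕ → ℝ
  lo : ℤ
  hi : ℤ
  layer_mem : ∀ t, ∀ i ∈ strands t, lo ≤ t ∧ t < hi
  nonempty : ∃ t, (strands t).Nonempty
  ordered : ∀ t, ∀ i ∈ strands t, ∀ j ∈ strands t, i < j →
    bot t i ≤ bot t j ∧ top t i ≤ top t j ∧ (bot t i < bot t j ∨ top t i < top t j)
  degree : ∀ (t : ℤ) (v : ℝ),
    #{i ∈ strands t | bot t i = v} + #{i ∈ strands (t - 1) | top (t - 1) i = v} = 0 ∨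
    #{i ∈ strands t | bot t i = v} + #{i ∈ strands (t - 1) | top (t - 1) i = v} = 2

lemma card_filter_comp_eq_sum {ι α : Type*} [DecidableEq α] {I : Finset ι} {V : Finset α}
    {f : ι → α} (hf : ∀ i ∈ I, f i ∈ V) (P : α → Prop) [DecidablePred P] :
    #{i ∈ I | P (f i)} = ∑ v ∈ V with P v, #{i ∈ I | f i = v} := by
  rw [Finset.sum_card_fiberwise_eq_card_filter]
  refine congrArg Finset.card (Finset.filter_congr fun i hi => ?_)
  simp only [Finset.mem_filter, hf i hi, true_and]

lemma even_card_filter_add_card_filter {ι κ α : Type*} [DecidableEq α] {J : Finset ι}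
    {K : Finset κ} {f : ι → α} {g : κ → α}
    (h : ∀ v, Even (#{i ∈ J | f i = v} + #{k ∈ K | g k = v})) (P : α → Prop) [DecidablePred P] :
    Even (#{i ∈ J | P (f i)} + #{k ∈ K | P (g k)}) := by
  have hf : ∀ i ∈ J, f i ∈ J.image f ∪ K.image g := fun i hi =>
    Finset.mem_union_left _ (Finset.mem_image_of_mem f hi)
  have hg : ∀ k ∈ K, g k ∈ J.image f ∪ K.image g := fun k hk =>
    Finset.mem_union_right _ (Finset.mem_image_of_mem g hk)
  rw [card_filter_comp_eq_sum hf, card_filter_comp_eq_sum hg, ← Finset.sum_add_distrib]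
  exact Finset.even_sum _ fun v _ => h v

namespace LayeredDrawing

variable {D : LayeredDrawing} {t : ℤ} {i j : ℕ} {p : Plane}

/-- The abscissa at height `y` of the line carrying the strand `i` of the layer `t`. -/
def X (D : LayeredDrawing) (t : ℤ) (i : ℕ) (y : ℝ) : ℝ :=
  D.bot t i * (t + 1 - y) + D.top t i * (y - t)

/-- The pairs of a layer and a strand in it: the edges of the drawing are indexed by this set. -/
def index (D : LayeredDrawing) : Set (ℤ × ℕ) := {x | x.2 ∈ D.strands x.1}

/-- The lower and the upper end of a strand. -/
def edge (D : LayeredDrawing) (x : ℤ × ℕ) : Plane × Plane :=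
  ((D.bot x.1 x.2, x.1), (D.top x.1 x.2, x.1 + 1))

/-- A strand as a set of points. -/
def seg (D : LayeredDrawing) (x : ℤ × ℕ) : Set Plane :=
  {p | x.1 ≤ p.2 ∧ p.2 ≤ x.1 + 1 ∧ p.1 = D.X x.1 x.2 p.2}

/-- The curve drawn by all strands. -/
def curve (D : LayeredDrawing) : Set Plane := ⋃ x ∈ D.index, D.seg x

/-- The strands of the layer `t` that pass to the left of `p`. -/
noncomputable def leftStrands (D : LayeredDrawing) (t : ℤ) (p : Plane) : Finset ℕ :=
  {i ∈ D.strands t | D.X t i p.2 < p.1}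

/-- The domain bounded by the curve: the points off the curve with an odd number of strands on the
left. -/
def region (D : LayeredDrawing) : Set Plane :=
  {p | p ∉ D.curve ∧ Odd #(D.leftStrands ⌊p.2⌋ p)}

/-- The points off the curve with an even number of strands on the left. -/
def exterior (D : LayeredDrawing) : Set Plane :=
  {p | p ∉ D.curve ∧ Even #(D.leftStrands ⌊p.2⌋ p)}

@[simp] lemma X_bot (t : ℤ) (i : ℕ) : D.X t i t = D.bot t i := by simp [X]

@[simp] lemma X_top (t : ℤ) (i : ℕ) : D.X t i (t + 1) = D.top t i := by simp [X]

@[simp] lemma X_pred (t : ℤ) (i : ℕ) : D.X (t - 1) i t = D.top (t - 1) i := by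
  simpa using D.X_top (t - 1) i

lemma continuous_X (t : ℤ) (i : ℕ) : Continuous (D.X t i) := by
  unfold X; fun_prop

lemma mem_curve :
    p ∈ D.curve ↔ ∃ t, ∃ i ∈ D.strands t, (t : ℝ) ≤ p.2 ∧ p.2 ≤ t + 1 ∧ p.1 = D.X t i p.2 := by
  simp only [curve, seg, index, mem_iUnion, Prod.exists, Set.mem_ofPred_eq, exists_prop]

lemma X_lt_X_of_bot_lt (hbot : D.bot t i < D.bot t j) (htop : D.top t i ≤ D.top t j) {y : ℝ}
    (hy : y ∈ Ico (t : ℝ) (t + 1)) : D.X t i y < D.X t j y :=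
  add_lt_add_of_lt_of_le (mul_lt_mul_of_pos_right hbot (sub_pos.2 hy.2))
    (mul_le_mul_of_nonneg_right htop (sub_nonneg.2 hy.1))

lemma X_lt_X_of_top_lt (hbot : D.bot t i ≤ D.bot t j) (htop : D.top t i < D.top t j) {y : ℝ}
    (hy : y ∈ Ioc (t : ℝ) (t + 1)) : D.X t i y < D.X t j y :=
  add_lt_add_of_le_of_lt (mul_le_mul_of_nonneg_right hbot (sub_nonneg.2 hy.2))
    (mul_lt_mul_of_pos_right htop (sub_pos.2 hy.1))

lemma X_lt_X (hi : i ∈ D.strands t) (hj : j ∈ D.strands t) (hij : i < j) {y : ℝ}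
    (hy : y ∈ Ioo (t : ℝ) (t + 1)) : D.X t i y < D.X t j y := by
  obtain ⟨hbot, htop, hlt | hlt⟩ := D.ordered t i hi j hj hij
  exacts [X_lt_X_of_bot_lt hlt htop (Ioo_subset_Ico_self hy),
    X_lt_X_of_top_lt hbot hlt (Ioo_subset_Ioc_self hy)]

lemma injOn_X {y : ℝ} (hy : y ∈ Ioo (t : ℝ) (t + 1)) : InjOn (D.X t · y) (D.strands t) :=
  StrictMonoOn.injOn fun _ hi _ hj hij => X_lt_X hi hj hij hy

lemma finite_index : D.index.Finite := by
  refine ((Finset.Ico D.lo D.hi).sigma D.strands |>.finite_toSet.image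
    fun x => (x.1, x.2)).subset ?_
  rintro ⟨t, i⟩ hi
  exact ⟨⟨t, i⟩, by simpa using ⟨D.layer_mem t i hi, hi⟩, rfl⟩

lemma seg_eq_segment (x : ℤ × ℕ) : D.seg x = segment ℝ (D.edge x).1 (D.edge x).2 := by
  ext p
  rw [segment_eq_image]
  simp only [seg, edge, X, Set.mem_ofPred_eq, Set.mem_image, Prod.smul_mk, smul_eq_mul,
    Prod.mk_add_mk]
  constructor
  · rintro ⟨h0, h1, hp⟩
    refine ⟨p.2 - x.1, ⟨by linarith, by linarith⟩, Prod.ext ?_ ?_⟩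
    · rw [hp]; ring
    · ring
  · rintro ⟨s, ⟨h0, h1⟩, rfl⟩
    exact ⟨by linarith, by linarith, by ring⟩

lemma isCompact_seg (x : ℤ × ℕ) : IsCompact (D.seg x) := by
  rw [seg_eq_segment, segment_eq_image]
  exact isCompact_Icc.image (by fun_prop)

lemma isCompact_curve : IsCompact D.curve :=
  D.finite_index.isCompact_biUnion fun _ _ => isCompact_seg _

lemma isClosed_curve : IsClosed D.curve := isCompact_curve.isClosed

lemma curve_nonempty : D.curve.Nonempty := by
  obtain ⟨t, i, hi⟩ := D.nonempty
  exact ⟨(D.bot t i, t), mem_curve.2 ⟨t, i, hi, le_rfl, by simp, by simp⟩⟩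

lemma eq_of_mem_seg_of_lt {x : ℤ × ℕ} (hp : p ∈ D.seg x) (h0 : (t : ℝ) < p.2)
    (h1 : p.2 < t + 1) : x.1 = t := by
  have hlt : (x.1 : ℝ) < t + 1 := hp.1.trans_lt h1
  have hgt : (t : ℝ) < x.1 + 1 := h0.trans_le hp.2.1
  norm_cast at hlt hgt
  omega

lemma mem_curve_iff_of_mem_Ioo {x y : ℝ} (hy : y ∈ Ioo (t : ℝ) (t + 1)) :
    (x, y) ∈ D.curve ↔ ∃ i ∈ D.strands t, D.X t i y = x := by
  rw [mem_curve]
  constructor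
  · rintro ⟨s, i, hi, hp⟩
    obtain rfl : s = t := eq_of_mem_seg_of_lt (D := D) (x := (s, i)) hp hy.1 hy.2
    exact ⟨i, hi, hp.2.2.symm⟩
  · rintro ⟨i, hi, rfl⟩
    exact ⟨t, i, hi, hy.1.le, hy.2.le, rfl⟩

/-! ### The domain bounded by a layered drawing -/

lemma even_degree (t : ℤ) (v : ℝ) :
    Even (#{i ∈ D.strands t | D.bot t i = v} +
      #{i ∈ D.strands (t - 1) | D.top (t - 1) i = v}) := by
  rcases D.degree t v with h | h <;> rw [h] <;> decide

lemma even_card_leftStrands_iff_of_level (h : p.2 = t) :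
    Even #(D.leftStrands t p) ↔ Even #(D.leftStrands (t - 1) p) := by
  have := even_card_filter_add_card_filter (D.even_degree t) (· < p.1)
  rw [Nat.even_add] at this
  simpa only [leftStrands, h, X_bot, X_pred] using this

lemma even_card_strands (t : ℤ) : Even #(D.strands t) := by
  have step (t : ℤ) : Even #(D.strands t) ↔ Even #(D.strands (t - 1)) := by
    simpa [Nat.even_add] using even_card_filter_add_card_filter (D.even_degree t) fun _ => True
  have empty (t : ℤ) (ht : D.hi ≤ t) : D.strands t = ∅ :=
    Finset.eq_empty_of_forall_notMem fun i hi => (D.layer_mem t i hi).2.not_ge ht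
  rcases le_total D.hi t with h | h
  · simp [empty t h]
  · induction t, h using Int.leInductionDown with
    | base => simp [empty]
    | pred t _ ih => exact (step t).1 ih

lemma odd_card_leftStrands_floor_iff (h0 : t ≤ p.2) (h1 : p.2 ≤ t + 1) :
    Odd #(D.leftStrands ⌊p.2⌋ p) ↔ Odd #(D.leftStrands t p) := by
  rcases h1.eq_or_lt with h1 | h1
  · have hp : p.2 = ((t + 1 : ℤ) : ℝ) := by rw [h1]; push_cast; rfl
    rw [hp, Int.floor_intCast, ← Nat.not_even_iff_odd, ← Nat.not_even_iff_odd,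
      even_card_leftStrands_iff_of_level hp, add_sub_cancel_right]
  · rw [Int.floor_eq_iff.2 ⟨h0, h1⟩]

lemma eventually_leftStrands_eq (hp : p ∉ D.curve) (h0 : t ≤ p.2) (h1 : p.2 ≤ t + 1) :
    ∀ᶠ q in 𝓝 p, D.leftStrands t q = D.leftStrands t p := by
  have hside (i) (hi : i ∈ D.strands t) :
      ∀ᶠ q : Plane in 𝓝 p, (D.X t i q.2 < q.1 ↔ D.X t i p.2 < p.1) := by
    have hcont : Continuous fun q : Plane => D.X t i q.2 := (continuous_X t i).comp continuous_snd
    rcases lt_trichotomy (D.X t i p.2) p.1 with h | h | h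
    · filter_upwards [hcont.continuousAt.eventually_lt continuous_fst.continuousAt h] with q hq
      exact iff_of_true hq h
    · exact absurd (mem_curve.2 ⟨t, i, hi, h0, h1, h.symm⟩) hp
    · filter_upwards [continuous_fst.continuousAt.eventually_lt hcont.continuousAt h] with q hq
      exact iff_of_false (lt_asymm hq) (lt_asymm h)
  filter_upwards [(Finset.eventually_all _).2 hside] with q hq
  exact Finset.filter_congr hq

lemma eventually_odd_iff_of_layer (hp : p ∉ D.curve) (h0 : (t : ℝ) ≤ p.2) (h1 : p.2 ≤ (t : ℝ) + 1) :
    ∀ᶠ q : Plane in 𝓝 p, (t : ℝ) ≤ q.2 → q.2 ≤ (t : ℝ) + 1 →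
      (Odd #(D.leftStrands ⌊q.2⌋ q) ↔ Odd #(D.leftStrands ⌊p.2⌋ p)) := by
  filter_upwards [eventually_leftStrands_eq hp h0 h1] with q hq hq0 hq1
  rw [odd_card_leftStrands_floor_iff hq0 hq1, hq, odd_card_leftStrands_floor_iff h0 h1]

lemma eventually_odd_iff (hp : p ∉ D.curve) :
    ∀ᶠ q in 𝓝 p, (Odd #(D.leftStrands ⌊q.2⌋ q) ↔ Odd #(D.leftStrands ⌊p.2⌋ p)) := by
  have hle := Int.floor_le p.2
  have hlt := Int.lt_floor_add_one p.2
  have above := eventually_odd_iff_of_layer hp hle hlt.le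
  have eventually_lt : ∀ᶠ q : Plane in 𝓝 p, q.2 < ⌊p.2⌋ + 1 :=
    continuous_snd.continuousAt.eventually_lt continuousAt_const hlt
  rcases hle.eq_or_lt with heq | hgt
  · have below := eventually_odd_iff_of_layer hp (t := ⌊p.2⌋ - 1) (by push_cast; linarith)
      (by push_cast; linarith)
    have eventually_gt : ∀ᶠ q : Plane in 𝓝 p, (⌊p.2⌋ : ℝ) - 1 < q.2 :=
      continuousAt_const.eventually_lt continuous_snd.continuousAt (by linarith)
    filter_upwards [above, below, eventually_lt, eventually_gt] with q above below hq1 hq0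
    rcases le_total (⌊p.2⌋ : ℝ) q.2 with h | h
    · exact above h hq1.le
    · exact below (by push_cast; exact hq0.le) (by push_cast; linarith)
  · filter_upwards [above, eventually_lt,
      continuousAt_const.eventually_lt continuous_snd.continuousAt hgt] with q above hq1 hq0
    exact above hq0.le hq1.le

lemma isOpen_region : IsOpen D.region := by
  refine isOpen_iff_mem_nhds.2 fun p hp => ?_
  filter_upwards [isClosed_curve.isOpen_compl.mem_nhds hp.1, eventually_odd_iff hp.1] with q hq hodd
  exact ⟨hq, hodd.2 hp.2⟩

lemma isOpen_exterior : IsOpen D.exterior := by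
  refine isOpen_iff_mem_nhds.2 fun p hp => ?_
  filter_upwards [isClosed_curve.isOpen_compl.mem_nhds hp.1, eventually_odd_iff hp.1] with q hq hodd
  refine ⟨hq, ?_⟩
  rw [← Nat.not_odd_iff_even, hodd, Nat.not_odd_iff_even]
  exact hp.2

lemma mem_region_or_mem_exterior (hp : p ∉ D.curve) : p ∈ D.region ∨ p ∈ D.exterior :=
  (Nat.even_or_odd _).symm.imp (⟨hp, ·⟩) (⟨hp, ·⟩)

lemma disjoint_region_exterior : Disjoint D.region D.exterior :=
  Set.disjoint_left.2 fun _ hp hp' => Nat.not_even_iff_odd.2 hp.2 hp'.2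

lemma eventually_leftStrands_of_mem_strands (hi : i ∈ D.strands t) {y : ℝ}
    (hy : y ∈ Ioo (t : ℝ) (t + 1)) :
    ∀ᶠ x in 𝓝 (D.X t i y), x ≠ D.X t i y → (x, y) ∉ D.curve ∧ D.leftStrands t (x, y) =
      if D.X t i y < x then insert i (D.leftStrands t (D.X t i y, y))
      else D.leftStrands t (D.X t i y, y) := by
  have others : ∀ j ∈ D.strands t, ∀ᶠ x in 𝓝 (D.X t i y),
      j ≠ i → x ≠ D.X t j y ∧ (D.X t j y < x ↔ D.X t j y < D.X t i y) := by
    intro j hj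
    by_cases hji : j = i
    · simp [hji]
    rcases ((injOn_X hy).ne hj hi hji).lt_or_gt with h | h
    · filter_upwards [Ioi_mem_nhds h] with x hx _
      exact ⟨hx.ne', iff_of_true hx h⟩
    · filter_upwards [Iio_mem_nhds h] with x hx _
      exact ⟨hx.ne, iff_of_false hx.not_gt h.not_gt⟩
  filter_upwards [(Finset.eventually_all _).2 others] with x hx hne
  constructor
  · rw [mem_curve_iff_of_mem_Ioo hy]
    rintro ⟨j, hj, rfl⟩
    by_cases hji : j = i
    · exact hne (by rw [hji])
    · exact (hx j hj hji).1 rfl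
  · ext j
    by_cases hji : j = i
    · subst hji
      split_ifs with hlt <;> simp [leftStrands, hi, hlt]
    · have hside (hj : j ∈ D.strands t) := (hx j hj hji).2
      split_ifs <;> simpa [leftStrands, hji] using hside

/-- Crossing a strand changes the parity, so both sides accumulate at each of its points. -/
lemma mem_closure_of_mem_strands (hi : i ∈ D.strands t) {y : ℝ} (hy : y ∈ Ioo (t : ℝ) (t + 1)) :
    (D.X t i y, y) ∈ closure D.region ∩ closure D.exterior := by
  have hfloor : ⌊y⌋ = t := Int.floor_eq_iff.2 ⟨hy.1.le, hy.2⟩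
  set x := D.X t i y with hx
  set L := D.leftStrands t (x, y) with hL
  have hcont (l : Filter ℝ) (hl : l ≤ 𝓝 x) : Tendsto (fun x' => ((x', y) : Plane)) l (𝓝 (x, y)) :=
    ((by fun_prop : Continuous fun x' : ℝ => ((x', y) : Plane)).tendsto x).mono_left hl
  have hnear := eventually_leftStrands_of_mem_strands hi hy
  have left : ∀ᶠ x' in 𝓝[<] x, (x', y) ∉ D.curve ∧ D.leftStrands ⌊y⌋ (x', y) = L := by
    filter_upwards [nhdsWithin_le_nhds hnear, self_mem_nhdsWithin] with x' h (hlt : x' < x)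
    simpa [hfloor, hlt.not_gt, ← hx] using h hlt.ne
  have right : ∀ᶠ x' in 𝓝[>] x,
      (x', y) ∉ D.curve ∧ D.leftStrands ⌊y⌋ (x', y) = insert i L := by
    filter_upwards [nhdsWithin_le_nhds hnear, self_mem_nhdsWithin] with x' h (hlt : x < x')
    simpa [hfloor, hlt, ← hx] using h hlt.ne'
  have hcard : #(insert i L) = #L + 1 :=
    Finset.card_insert_of_notMem (by simp [hL, leftStrands, ← hx])
  rcases Nat.even_or_odd #L with hL | hL
  · have hR : Odd #(insert i L) := hcard ▸ hL.add_one
    exact ⟨mem_closure_of_tendsto (hcont _ nhdsWithin_le_nhds)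
        (right.mono fun x' h => ⟨h.1, h.2 ▸ hR⟩),
      mem_closure_of_tendsto (hcont _ nhdsWithin_le_nhds) (left.mono fun x' h => ⟨h.1, h.2 ▸ hL⟩)⟩
  · have hR : Even #(insert i L) := hcard ▸ hL.add_one
    exact ⟨mem_closure_of_tendsto (hcont _ nhdsWithin_le_nhds)
        (left.mono fun x' h => ⟨h.1, h.2 ▸ hL⟩),
      mem_closure_of_tendsto (hcont _ nhdsWithin_le_nhds) (right.mono fun x' h => ⟨h.1, h.2 ▸ hR⟩)⟩

lemma curve_subset_closure_inter_closure : D.curve ⊆ closure D.region ∩ closure D.exterior := by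
  intro p hp
  obtain ⟨t, i, hi, h0, h1, hX⟩ := mem_curve.1 hp
  have hcont : Continuous fun y : ℝ => ((D.X t i y, y) : Plane) :=
    (continuous_X t i).prodMk continuous_id
  have hy : p.2 ∈ closure (Ioo (t : ℝ) (t + 1)) := by
    rw [closure_Ioo (lt_add_one _).ne]
    exact ⟨h0, h1⟩
  have := map_mem_closure hcont hy fun y hy => mem_closure_of_mem_strands hi hy
  rwa [(isClosed_closure.inter isClosed_closure).closure_eq, ← hX] at this

lemma closure_region : closure D.region = D.region ∪ D.curve := by
  refine Subset.antisymm (fun p hp => ?_)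
    (union_subset subset_closure fun p hp => (curve_subset_closure_inter_closure hp).1)
  by_cases hc : p ∈ D.curve
  · exact Or.inr hc
  · exact Or.inl ((mem_region_or_mem_exterior hc).resolve_right
      (Set.disjoint_left.1 (disjoint_region_exterior.closure_left isOpen_exterior) hp))

lemma frontier_region : frontier D.region = D.curve := by
  rw [isOpen_region.frontier_eq, closure_region, union_sdiff_left]
  exact sdiff_eq_left.2 (Set.disjoint_left.2 fun p hp h => h.1 hp)

lemma interior_closure_region : interior (closure D.region) = D.region := by
  refine Subset.antisymm (fun p hp => ?_) (interior_maximal subset_closure isOpen_region)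
  refine (closure_region ▸ interior_subset hp).resolve_right fun hc => ?_
  have hdisj : Disjoint (interior (closure D.region)) (closure D.exterior) :=
    ((disjoint_region_exterior.closure_left isOpen_exterior).mono_left
      interior_subset).closure_right isOpen_interior
  exact Set.disjoint_left.1 hdisj hp (curve_subset_closure_inter_closure hc).2

lemma exists_mem_curve_le_ge_of_mem_region (hp : p ∈ D.region) :
    (∃ x ≤ p.1, (x, p.2) ∈ D.curve) ∧ ∃ x ≥ p.1, (x, p.2) ∈ D.curve := by
  have hmem (i) (hi : i ∈ D.strands ⌊p.2⌋) : (D.X ⌊p.2⌋ i p.2, p.2) ∈ D.curve :=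
    mem_curve.2 ⟨_, i, hi, Int.floor_le _, (Int.lt_floor_add_one _).le, rfl⟩
  constructor
  · obtain ⟨i, hi⟩ := Finset.card_pos.1 hp.2.pos
    obtain ⟨hi, hlt⟩ := Finset.mem_filter.1 hi
    exact ⟨_, hlt.le, hmem i hi⟩
  · by_contra! hlt
    have hall : D.leftStrands ⌊p.2⌋ p = D.strands ⌊p.2⌋ :=
      Finset.filter_true_of_mem fun i hi => not_le.1 fun hge => hlt _ hge (hmem i hi)
    exact Nat.not_even_iff_odd.2 hp.2 (hall ▸ even_card_strands _)

lemma height_mem_Icc_of_mem_region (hp : p ∈ D.region) : p.2 ∈ Icc (D.lo : ℝ) D.hi := by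
  obtain ⟨x, -, hx⟩ := (exists_mem_curve_le_ge_of_mem_region hp).1
  obtain ⟨t, i, hi, h0, h1, -⟩ := mem_curve.1 hx
  have hlo : (D.lo : ℝ) ≤ t := by exact_mod_cast (D.layer_mem t i hi).1
  have hhi : (t : ℝ) + 1 ≤ D.hi := by exact_mod_cast (D.layer_mem t i hi).2
  exact ⟨hlo.trans h0, h1.trans hhi⟩

lemma isBounded_region : Bornology.IsBounded D.region := by
  obtain ⟨⟨a, ha⟩, ⟨b, hb⟩⟩ := isBounded_iff_bddBelow_bddAbove.1 D.isCompact_curve.isBounded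
  refine isBounded_iff_bddBelow_bddAbove.2 ⟨⟨a, fun p hp => ?_⟩, ⟨b, fun p hp => ?_⟩⟩
  · obtain ⟨x, hxp, hx⟩ := (exists_mem_curve_le_ge_of_mem_region hp).1
    exact ⟨(ha hx).1.trans hxp, (ha hx).2⟩
  · obtain ⟨x, hpx, hx⟩ := (exists_mem_curve_le_ge_of_mem_region hp).2
    exact ⟨hpx.le.trans (hb hx).1, (hb hx).2⟩

lemma region_nonempty : D.region.Nonempty :=
  closure_nonempty_iff.1 (curve_nonempty.mono fun _ hp => (curve_subset_closure_inter_closure hp).1)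

lemma injOn_edge : InjOn D.edge D.index := by
  rintro ⟨t, i⟩ hi ⟨s, j⟩ hj h
  simp only [edge, Prod.mk.injEq, Int.cast_inj] at h
  obtain ⟨⟨hbot, rfl⟩, htop, -⟩ := h
  rcases lt_trichotomy i j with hij | rfl | hji
  · obtain ⟨-, -, h | h⟩ := D.ordered t i hi j hj hij
    exacts [absurd hbot h.ne, absurd htop h.ne]
  · rfl
  · obtain ⟨-, -, h | h⟩ := D.ordered t j hj i hi hji
    exacts [absurd hbot h.ne', absurd htop h.ne']

lemma eq_end_of_mem_seg {x y : ℤ × ℕ} (hx : x ∈ D.index) (hy : y ∈ D.index) (hxy : x ≠ y)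
    (hpx : p ∈ D.seg x) (hpy : p ∈ D.seg y) : p = (D.edge x).1 ∨ p = (D.edge x).2 := by
  obtain ⟨t, i⟩ := x
  obtain ⟨s, j⟩ := y
  have ⟨h0, h1, hX⟩ := hpx
  rcases h0.eq_or_lt with h0 | h0
  · exact .inl (Prod.ext (by rw [hX, ← h0, X_bot]; rfl) h0.symm)
  rcases h1.eq_or_lt with h1 | h1
  · exact .inr (Prod.ext (by rw [hX, h1, X_top]; rfl) h1)
  obtain rfl : s = t := eq_of_mem_seg_of_lt hpy h0 h1
  exact absurd (congrArg (Prod.mk s) (injOn_X ⟨h0, h1⟩ hx hy (hX.symm.trans hpy.2.2))) hxy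

lemma ncard_edges_at (t : ℤ) (v : ℝ) :
    {x ∈ D.index | ((v, (t : ℝ)) : Plane) = (D.edge x).1 ∨ (v, (t : ℝ)) = (D.edge x).2}.ncard =
      #{i ∈ D.strands t | D.bot t i = v} + #{i ∈ D.strands (t - 1) | D.top (t - 1) i = v} := by
  have heq : {x ∈ D.index | ((v, (t : ℝ)) : Plane) = (D.edge x).1 ∨ (v, (t : ℝ)) = (D.edge x).2} =
      Prod.mk t '' {i ∈ D.strands t | D.bot t i = v} ∪
        Prod.mk (t - 1) '' {i ∈ D.strands (t - 1) | D.top (t - 1) i = v} := by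
    ext ⟨s, i⟩
    constructor
    · rintro ⟨hi, h | h⟩
      · simp only [edge, Prod.mk.injEq, Int.cast_inj] at h
        obtain ⟨hv, rfl⟩ := h
        exact .inl ⟨i, ⟨hi, hv.symm⟩, rfl⟩
      · simp only [edge, Prod.mk.injEq] at h
        obtain ⟨hv, ht⟩ := h
        obtain rfl : t = s + 1 := by exact_mod_cast ht
        rw [add_sub_cancel_right]
        exact .inr ⟨i, ⟨hi, hv.symm⟩, rfl⟩
    · rintro (⟨i, ⟨hi, rfl⟩, ⟨⟩⟩ | ⟨i, ⟨hi, rfl⟩, ⟨⟩⟩)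
      · exact ⟨hi, .inl rfl⟩
      · exact ⟨hi, .inr (by simp [edge])⟩
  have hdisj : Disjoint (Prod.mk t '' {i | i ∈ D.strands t ∧ D.bot t i = v})
      (Prod.mk (t - 1) '' {i | i ∈ D.strands (t - 1) ∧ D.top (t - 1) i = v}) := by
    rw [Set.disjoint_left]
    rintro _ ⟨i, -, rfl⟩ ⟨j, -, h⟩
    simp at h
  rw [heq, ← Finset.coe_filter, ← Finset.coe_filter, ncard_union_eq (by simpa using hdisj),
    ncard_image_of_injective _ (Prod.mk_right_injective _),
    ncard_image_of_injective _ (Prod.mk_right_injective _), ncard_coe_finset, ncard_coe_finset]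

lemma isPolygonalCurve_curve : IsPolygonalCurve D.curve := by
  refine ⟨D.edge '' D.index, D.finite_index.image _, ?_, ?_, ?_, ?_⟩
  · simp only [curve, biUnion_image, seg_eq_segment]
  · rintro _ ⟨x, -, rfl⟩ h
    simpa [edge] using congrArg Prod.snd h
  · rintro _ ⟨x, hx, rfl⟩ _ ⟨y, hy, rfl⟩ hne p ⟨hpx, hpy⟩
    rw [← seg_eq_segment] at hpx hpy
    have hxy : x ≠ y := ne_of_apply_ne _ hne
    exact ⟨eq_end_of_mem_seg hx hy hxy hpx hpy, eq_end_of_mem_seg hy hx hxy.symm hpy hpx⟩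
  · rintro _ ⟨x, hx, rfl⟩ v hv
    obtain ⟨v, t, rfl⟩ : ∃ (a : ℝ) (t : ℤ), v = (a, (t : ℝ)) := by
      rcases hv with rfl | rfl
      exacts [⟨_, _, rfl⟩, ⟨D.top x.1 x.2, x.1 + 1, by simp [edge]⟩]
    have himage :
        {f | f ∈ D.edge '' D.index ∧ (((v, (t : ℝ)) : Plane) = f.1 ∨ (v, (t : ℝ)) = f.2)} =
          D.edge '' {x ∈ D.index | ((v, (t : ℝ)) : Plane) = (D.edge x).1 ∨
            (v, (t : ℝ)) = (D.edge x).2} := by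
      ext f
      constructor
      · rintro ⟨⟨y, hy, rfl⟩, h⟩
        exact ⟨y, ⟨hy, h⟩, rfl⟩
      · rintro ⟨y, ⟨hy, h⟩, rfl⟩
        exact ⟨⟨y, hy, rfl⟩, h⟩
    rw [himage, (injOn_edge.mono (sep_subset _ _)).ncard_image, ncard_edges_at]
    refine (D.degree t v).resolve_left ?_
    rw [← ncard_edges_at]
    exact ((ncard_pos (D.finite_index.subset (sep_subset _ _))).2 ⟨x, hx, hv⟩).ne'

lemma isPlaneDomain_region : IsPlaneDomain D.region where
  nonempty := region_nonempty
  isOpen := isOpen_region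
  isBounded := isBounded_region
  regular := interior_closure_region
  boundary := by rw [frontier_region]; exact isPolygonalCurve_curve

end LayeredDrawing

/-! ### Noncritical heights -/

lemma not_isLocalExtr_of_strictMonoOn {f : ℝ → ℝ} {s : ℝ} {V : Set ℝ} (hV : V ∈ 𝓝 s)
    (hf : StrictMonoOn f V) : ¬ IsLocalExtr f s := by
  rintro (hmin | hmax)
  · obtain ⟨r, hrs, hr, hrV⟩ := ((frequently_lt_nhds s).and_eventually (hmin.and hV)).exists
    exact (hf hrV (mem_of_mem_nhds hV) hrs).not_ge hr
  · obtain ⟨r, hsr, hr, hrV⟩ := ((frequently_gt_nhds s).and_eventually (hmax.and hV)).exists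
    exact (hf (mem_of_mem_nhds hV) hrV hsr).not_ge hr

lemma not_isLocalExtr_of_injOn {f : ℝ → ℝ} {s : ℝ} {V : Set ℝ} (hV : V ∈ 𝓝 s)
    (hf : ContinuousOn f V) (hinj : InjOn f V) : ¬ IsLocalExtr f s := by
  obtain ⟨a, b, -, hnhds, hsub⟩ := exists_Icc_mem_subset_of_mem_nhds hV
  have hab : a ≤ b := nonempty_Icc.1 (nonempty_of_mem (mem_of_mem_nhds hnhds))
  rcases (hf.mono hsub).strictMonoOn_of_injOn_Icc' hab (hinj.mono hsub) with hmono | hanti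
  · exact not_isLocalExtr_of_strictMonoOn hnhds hmono
  · exact fun hext => not_isLocalExtr_of_strictMonoOn hnhds hanti.neg hext.neg

lemma not_isCritical_of_injOn {K : Set Plane} {c : ℝ}
    (h : ∀ p ∈ K, p.2 = c → ∃ U ∈ 𝓝 p, InjOn Prod.snd (K ∩ U)) : ¬ IsCritical K c := by
  rintro ⟨A, hAK, p, q, ⟨γ, hγ, hγinj, rfl, rfl, rfl⟩, hp, hq, ⟨_, ⟨s, hs, rfl⟩, rfl⟩, hext⟩
  have hs0 : 0 < s := hs.1.lt_of_ne (by rintro rfl; exact hp rfl)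
  have hs1 : s < 1 := hs.2.lt_of_ne (by rintro rfl; exact hq rfl)
  have hIcc : Icc (0 : ℝ) 1 ∈ 𝓝 s := Icc_mem_nhds hs0 hs1
  obtain ⟨U, hU, hUinj⟩ := h _ (hAK ⟨s, hs, rfl⟩) rfl
  refine not_isLocalExtr_of_injOn (f := fun r => (γ r).2)
    (inter_mem hIcc ((hγ.continuousAt hIcc).preimage_mem_nhds hU))
    (continuous_snd.comp_continuousOn (hγ.mono inter_subset_left)) ?_
    (hext.imp (fun hmin => ?_) fun hmax => ?_)
  · intro r hr r' hr' heq
    exact hγinj hr.1 hr'.1 (hUinj ⟨hAK ⟨r, hr.1, rfl⟩, hr.2⟩ ⟨hAK ⟨r', hr'.1, rfl⟩, hr'.2⟩ heq)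
  · filter_upwards [hIcc] with r hr using hmin _ ⟨r, hr, rfl⟩
  · filter_upwards [hIcc] with r hr using hmax _ ⟨r, hr, rfl⟩

namespace LayeredDrawing

variable {D : LayeredDrawing} {t : ℤ} {i j : ℕ} {p : Plane}

lemma eventually_exists_mem_seg (D : LayeredDrawing) (p : Plane) :
    ∀ᶠ q in 𝓝 p, q ∈ D.curve → ∃ x ∈ D.index, p ∈ D.seg x ∧ q ∈ D.seg x := by
  have hclosed (x) (_ : x ∈ D.index) : ∀ᶠ q in 𝓝 p, q ∈ D.seg x → p ∈ D.seg x := by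
    by_cases hp : p ∈ D.seg x
    · exact .of_forall fun _ _ => hp
    · filter_upwards [(isCompact_seg x).isClosed.isOpen_compl.mem_nhds hp] with q hq h
      exact absurd h hq
  filter_upwards [D.finite_index.eventually_all.2 hclosed] with q hq hqc
  obtain ⟨x, hx, hqx⟩ := mem_iUnion₂.1 hqc
  exact ⟨x, hx, hq x hx hqx, hqx⟩

lemma eq_of_mem_seg_of_snd_eq {x y : ℤ × ℕ} {q r : Plane} (hpx : p ∈ D.seg x) (hpy : p ∈ D.seg y)
    (hqx : q ∈ D.seg x) (hry : r ∈ D.seg y) (hqr : q.2 = r.2) (hxy : x.1 = y.1 → x = y) :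
    q = r := by
  wlog hle : x.1 ≤ y.1 generalizing x y q r
  · exact (this hpy hpx hry hqx hqr.symm (fun h => (hxy h.symm).symm) (le_of_not_ge hle)).symm
  rcases hle.eq_or_lt with heq | hlt
  · obtain rfl := hxy heq
    exact Prod.ext (by rw [hqx.2.2, hry.2.2, hqr]) hqr
  · have hlt : (x.1 : ℝ) + 1 ≤ y.1 := by exact_mod_cast hlt
    have hq : q.2 = p.2 := by linarith [hqx.2.1, hry.1, hpx.2.1, hpy.1]
    refine Prod.ext ?_ hqr
    rw [hqx.2.2, hry.2.2, ← hqr, hq, ← hpx.2.2, ← hpy.2.2]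

lemma not_isCritical_of_forall_seg {c : ℝ}
    (h : ∀ p : Plane, p.2 = c → ∀ x ∈ D.index, ∀ y ∈ D.index, p ∈ D.seg x → p ∈ D.seg y →
      x.1 = y.1 → x = y) : ¬ IsCritical D.curve c := by
  refine not_isCritical_of_injOn fun p _ hpc => ⟨_, D.eventually_exists_mem_seg p, ?_⟩
  rintro q ⟨hq, hq'⟩ r ⟨hr, hr'⟩ hqr
  obtain ⟨x, hx, hpx, hqx⟩ := hq' hq
  obtain ⟨y, hy, hpy, hry⟩ := hr' hr
  exact eq_of_mem_seg_of_snd_eq hpx hpy hqx hry hqr (h p hpc x hx y hy hpx hpy)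

lemma not_isCritical_of_mem_Ioo {c : ℝ} (hc : c ∈ Ioo (t : ℝ) (t + 1)) :
    ¬ IsCritical D.curve c := by
  refine not_isCritical_of_forall_seg ?_
  rintro p rfl ⟨s, i⟩ hx ⟨s', j⟩ hy hpx hpy -
  obtain rfl : s = t := eq_of_mem_seg_of_lt hpx hc.1 hc.2
  obtain rfl : s' = s := eq_of_mem_seg_of_lt hpy hc.1 hc.2
  exact congrArg (Prod.mk s') (injOn_X hc hx hy (hpx.2.2.symm.trans hpy.2.2))

/-- At most one strand of the layer above the level `t`, and at most one of the layer below, ends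
at any given point of this level. -/
def IsSimpleLevel (D : LayeredDrawing) (t : ℤ) : Prop :=
  InjOn (D.bot t) (D.strands t) ∧ InjOn (D.top (t - 1)) (D.strands (t - 1))

lemma IsSimpleLevel.not_isCritical (ht : D.IsSimpleLevel t) : ¬ IsCritical D.curve t := by
  refine not_isCritical_of_forall_seg ?_
  rintro p hp ⟨s, i⟩ hx ⟨s', j⟩ hy hpx hpy hs
  obtain rfl : s = s' := hs
  obtain ⟨h0, h1, hX⟩ := hpx
  have hXX : D.X s i p.2 = D.X s j p.2 := hX.symm.trans hpy.2.2
  rw [hp] at h0 h1 hXX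
  norm_cast at h0 h1
  obtain rfl | rfl : s = t ∨ s = t - 1 := by dsimp only at h0 h1; omega
  · exact congrArg (Prod.mk s) (ht.1 hx hy (by simpa using hXX))
  · exact congrArg (Prod.mk (t - 1)) (ht.2 hx hy (by simpa using hXX))

end LayeredDrawing

/-! ### Arcs -/

lemma isArc_image_Icc {γ : ℝ → Plane} {a b : ℝ} (hab : a < b) (hγ : ContinuousOn γ (Icc a b))
    (hinj : InjOn γ (Icc a b)) : IsArc (γ '' Icc a b) (γ a) (γ b) := by
  have himage : AffineMap.lineMap a b '' Icc (0 : ℝ) 1 = Icc a b := by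
    rw [← segment_eq_image_lineMap, segment_eq_Icc hab.le]
  have hmaps : MapsTo (AffineMap.lineMap a b) (Icc (0 : ℝ) 1) (Icc a b) :=
    himage ▸ mapsTo_image _ _
  refine ⟨γ ∘ AffineMap.lineMap a b, hγ.comp (by fun_prop) hmaps,
    hinj.comp (AffineMap.lineMap_injective ℝ hab.ne).injOn hmaps, ?_, ?_, ?_⟩
  · rw [image_comp, himage]
  · simp
  · simp

lemma isArc_graph {X : ℝ → ℝ} (hX : Continuous X) {a b : ℝ} (hab : a < b) :
    IsArc {p | p.1 = X p.2 ∧ a ≤ p.2 ∧ p.2 ≤ b} (X a, a) (X b, b) := by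
  have himage :
      (fun y => ((X y, y) : Plane)) '' Icc a b = {p | p.1 = X p.2 ∧ a ≤ p.2 ∧ p.2 ≤ b} := by
    ext p
    constructor
    · rintro ⟨y, hy, rfl⟩
      exact ⟨rfl, hy⟩
    · rintro ⟨hp, hy⟩
      exact ⟨p.2, hy, Prod.ext hp.symm rfl⟩
  rw [← himage]
  exact isArc_image_Icc hab (by fun_prop) fun y _ y' _ h => (Prod.ext_iff.1 h).2

namespace IsArc

variable {A B : Set Plane} {p q r : Plane}

lemma left_mem (h : IsArc A p q) : p ∈ A := by
  obtain ⟨γ, -, -, rfl, rfl, -⟩ := h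
  exact mem_image_of_mem γ (by simp)

lemma symm (h : IsArc A p q) : IsArc A q p := by
  obtain ⟨γ, hγ, hinj, rfl, rfl, rfl⟩ := h
  have himage : (fun s : ℝ => 1 - s) '' Icc 0 1 = Icc 0 1 := by simp
  have hmaps : MapsTo (fun s : ℝ => 1 - s) (Icc 0 1) (Icc 0 1) :=
    mapsTo_iff_image_subset.2 himage.le
  refine ⟨γ ∘ fun s => 1 - s, hγ.comp (by fun_prop) hmaps,
    hinj.comp sub_right_injective.injOn hmaps, ?_, by simp, by simp⟩
  rw [image_comp, himage]

lemma right_mem (h : IsArc A p q) : q ∈ A := h.symm.left_mem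

lemma isPreconnected (h : IsArc A p q) : IsPreconnected A := by
  obtain ⟨γ, hγ, -, rfl, -, -⟩ := h
  exact isPreconnected_Icc.image γ hγ

lemma union (hA : IsArc A p q) (hB : IsArc B q r) (hAB : A ∩ B ⊆ {q}) : IsArc (A ∪ B) p r := by
  obtain ⟨α, hα, hαinj, rfl, rfl, rfl⟩ := hA
  obtain ⟨β, hβ, hβinj, rfl, hβα, rfl⟩ := hB
  set γ : ℝ → Plane := fun s => if s ≤ 1 then α s else β (s - 1) with hγ
  have hsub : MapsTo (fun s : ℝ => s - 1) (Icc 1 2) (Icc 0 1) :=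
    fun s hs => ⟨by linarith [hs.1], by linarith [hs.2]⟩
  have hγα : EqOn γ α (Icc 0 1) := fun s hs => if_pos hs.2
  have hγβ : EqOn γ (fun s => β (s - 1)) (Icc 1 2) := fun s hs => by
    rcases hs.1.eq_or_lt with rfl | h
    · simp [hγ, hβα]
    · exact if_neg h.not_ge
  have hIcc : Icc (0 : ℝ) 1 ∪ Icc 1 2 = Icc 0 2 :=
    Icc_union_Icc_eq_Icc zero_le_one one_le_two
  have hcont : ContinuousOn γ (Icc 0 2) := hIcc ▸ (hα.congr hγα).union_of_isClosed
    ((hβ.comp (by fun_prop) hsub).congr hγβ) isClosed_Icc isClosed_Icc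
  have hinj : InjOn γ (Icc 0 2) := by
    rw [← Icc_union_Ioc_eq_Icc zero_le_one one_le_two, injOn_union (Set.disjoint_left.2
      fun s hs hs' => hs.2.not_gt hs'.1)]
    refine ⟨hαinj.congr hγα.symm, ?_, fun s hs s' hs' heq => ?_⟩
    · exact ((hβinj.comp (sub_left_injective.injOn) hsub).congr hγβ.symm).mono Ioc_subset_Icc_self
    · rw [hγα hs, hγβ (Ioc_subset_Icc_self hs')] at heq
      have hs'01 := hsub (Ioc_subset_Icc_self hs')
      have hq : α s = α 1 := hAB ⟨⟨s, hs, rfl⟩, ⟨_, hs'01, heq.symm⟩⟩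
      have := hβinj hs'01 (by simp) (heq.symm.trans (hq.trans hβα.symm))
      exact hs'.1.ne' (sub_eq_zero.1 this)
  have himage : γ '' Icc 0 2 = α '' Icc 0 1 ∪ β '' Icc 0 1 := by
    rw [← hIcc, image_union, hγα.image_eq, hγβ.image_eq, ← image_image β (· - 1),
      image_sub_const_Icc]
    norm_num
  have hend : γ 2 = β 1 := (hγβ (by simp)).trans (congrArg β (by norm_num))
  have := isArc_image_Icc two_pos hcont hinj
  rwa [himage, hγα (by simp), hend] at this

lemma subset_or_subset_of_inter_subset_right {L R : Set Plane} (hA : IsArc A p q)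
    (hL : IsClosed L) (hR : IsClosed R) (hALR : A ⊆ L ∪ R) (hLR : L ∩ R ⊆ {q}) :
    A ⊆ L ∨ A ⊆ R := by
  obtain ⟨γ, hγ, hinj, rfl, rfl, rfl⟩ := hA
  have hclosure : closure (Ico (0 : ℝ) 1) = Icc 0 1 := closure_Ico zero_ne_one
  have extend {F : Set Plane} (hF : IsClosed F) (h : γ '' Ico 0 1 ⊆ F) : γ '' Icc 0 1 ⊆ F := by
    rw [← hclosure] at hγ ⊢
    exact hγ.image_closure.trans (closure_minimal h hF)
  have hsub : γ '' Ico 0 1 ⊆ L ∪ R := (image_mono Ico_subset_Icc_self).trans hALR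
  have hdisj : γ '' Ico 0 1 ∩ (L ∩ R) = ∅ := by
    rw [← disjoint_iff_inter_eq_empty, Set.disjoint_left]
    rintro _ ⟨s, hs, rfl⟩ hLRs
    exact hs.2.ne (hinj (Ico_subset_Icc_self hs) (by simp) (hLR hLRs))
  have hpre : IsPreconnected (γ '' Ico 0 1) :=
    isPreconnected_Ico.image γ (hγ.mono Ico_subset_Icc_self)
  exact (isPreconnected_iff_subset_of_disjoint_closed.1 hpre L R hL hR hsub hdisj).imp
    (extend hL) (extend hR)

lemma subset_or_subset {L R : Set Plane} {o : Plane} (hA : IsArc A p q)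
    (hL : IsClosed L) (hR : IsClosed R) (hALR : A ⊆ L ∪ R) (hLR : L ∩ R ⊆ {o})
    (ho : o ∈ A → o = p ∨ o = q) : A ⊆ L ∨ A ⊆ R := by
  by_cases hoA : o ∈ A
  · rcases ho hoA with rfl | rfl
    · exact hA.symm.subset_or_subset_of_inter_subset_right hL hR hALR hLR
    · exact hA.subset_or_subset_of_inter_subset_right hL hR hALR hLR
  · refine isPreconnected_iff_subset_of_disjoint_closed.1 hA.isPreconnected L R hL hR hALR ?_
    rw [← disjoint_iff_inter_eq_empty]
    exact Set.disjoint_left.2 fun x hx hLRx => hoA (hLR hLRx ▸ hx)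

end IsArc

/-! ### Bands with one critical level -/

/-- The strand of type `t` of the band `[h, H]` with the critical level `g`: the graph of `X` over
the lower half of the band for `B`, over the upper one for `D`, and over the whole band for `C`. -/
def strandSet (h g H : ℝ) (t : Symbol) (X : ℝ → ℝ) : Set Plane :=
  {p | p.1 = X p.2 ∧ (if t = Symbol.D then g else h) ≤ p.2 ∧
    p.2 ≤ (if t = Symbol.B then g else H)}

/-- A presentation of the boundary of `S` in the band `[h, H]` by `n` strands listed from left to
right: off the level `g` strands are disjoint, on it a strand of type `C` meets no other one, and
those of type `B` or `D` meet in pairs of the same type. -/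
structure Strip (S : Set Plane) (h g H : ℝ) where
  n : ℕ
  ty : ℕ → Symbol
  X : ℕ → ℝ → ℝ
  lt_mid : h < g
  mid_lt : g < H
  ty_ne_sep : ∀ i < n, ty i ≠ Symbol.sep
  continuous_X : ∀ i, Continuous (X i)
  mem_bandBoundary_iff : ∀ p, p ∈ bandBoundary S h H ↔ ∃ i < n, p ∈ strandSet h g H (ty i) (X i)
  X_lt : ∀ i j, i < j → j < n → ∀ p ∈ strandSet h g H (ty i) (X i),
    ∀ q ∈ strandSet h g H (ty j) (X j), p.2 = q.2 → p.2 ≠ g → p.1 < q.1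
  X_mid_le : ∀ i j, i < j → j < n → X i g ≤ X j g
  single : ∀ i < n, ty i = Symbol.C → ∀ k < n, X k g = X i g → k = i
  pair : ∀ i < n, ty i ≠ Symbol.C → ∃ j < n, j ≠ i ∧ ty j = ty i ∧
    ∀ k < n, X k g = X i g ↔ k = i ∨ k = j
  isUnicritical : IsUnicritical S h H
  eq_mid : ∀ c ∈ Icc h H, IsCritical (frontier S) c → c = g

namespace Strip

variable {S : Set Plane} {h g H : ℝ} {T : Strip S h g H} {i j : ℕ} {p : Plane}

/-- The `i`-th strand from the left. -/
def strand (T : Strip S h g H) (i : ℕ) : Set Plane := strandSet h g H (T.ty i) (T.X i)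

/-- The height of the lower end of a strand. -/
def start (T : Strip S h g H) (i : ℕ) : ℝ := if T.ty i = Symbol.D then g else h

/-- The height of the upper end of a strand. -/
def finish (T : Strip S h g H) (i : ℕ) : ℝ := if T.ty i = Symbol.B then g else H

/-- The height of the end of a strand of type `B` or `D` that lies on the boundary of the band. -/
def outer (T : Strip S h g H) (i : ℕ) : ℝ := if T.ty i = Symbol.B then h else H

/-- The union of the strands through the point `(x, g)` of the critical level. -/
def piece (T : Strip S h g H) (x : ℝ) : Set Plane := ⋃ i ∈ {i | i < T.n ∧ T.X i g = x}, T.strand i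

lemma ty_eq_B_or_D (hi : i < T.n) (hC : T.ty i ≠ Symbol.C) :
    T.ty i = Symbol.B ∨ T.ty i = Symbol.D := by
  have := T.ty_ne_sep i hi
  cases h : T.ty i <;> simp_all

lemma start_lt_finish : T.start i < T.finish i := by
  have := T.lt_mid
  have := T.mid_lt
  unfold start finish
  split_ifs with hD hB
  · simp [hD] at hB
  all_goals linarith

lemma isArc_strand :
    IsArc (T.strand i) (T.X i (T.start i), T.start i) (T.X i (T.finish i), T.finish i) :=
  isArc_graph (T.continuous_X i) start_lt_finish

lemma isCrossing_strand : IsCrossing (T.strand i) :=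
  ⟨_, _, isArc_strand, fun _ hx => hx.2⟩

lemma isClosed_strand : IsClosed (T.strand i) :=
  (isClosed_eq continuous_fst ((T.continuous_X i).comp continuous_snd)).inter
    ((isClosed_le continuous_const continuous_snd).inter
      (isClosed_le continuous_snd continuous_const))

lemma isClosed_biUnion_strand {s : Set ℕ} (hs : s ⊆ Iio T.n) :
    IsClosed (⋃ i ∈ s, T.strand i) :=
  ((finite_Iio T.n).subset hs).isClosed_biUnion fun _ _ => isClosed_strand

lemma mid_mem_strand : (T.X i g, g) ∈ T.strand i := by
  have := T.lt_mid.le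
  have := T.mid_lt.le
  refine ⟨rfl, ?_, ?_⟩ <;> dsimp only <;> split_ifs <;> first | exact le_rfl | assumption

lemma strand_subset (hi : i < T.n) : T.strand i ⊆ bandBoundary S h H :=
  fun p hp => (T.mem_bandBoundary_iff p).2 ⟨i, hi, hp⟩

lemma strand_subset_piece (hi : i < T.n) : T.strand i ⊆ T.piece (T.X i g) :=
  subset_biUnion_of_mem (u := T.strand) (show i ∈ {k | k < T.n ∧ T.X k g = T.X i g} from ⟨hi, rfl⟩)

lemma piece_subset (x : ℝ) : T.piece x ⊆ bandBoundary S h H :=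
  iUnion₂_subset fun _ hk => strand_subset hk.1

lemma inter_subset (hi : i < T.n) (hj : j < T.n) (hij : i ≠ j) :
    T.strand i ∩ T.strand j ⊆ {(T.X i g, g)} := by
  rintro p ⟨hpi, hpj⟩
  have hp : p.2 = g := by
    by_contra hp
    rcases hij.lt_or_gt with hij | hij
    · exact (T.X_lt i j hij hj p hpi p hpj rfl hp).false
    · exact (T.X_lt j i hij hi p hpj p hpi rfl hp).false
  exact Prod.ext (hp ▸ hpi.1) hp

lemma disjoint_strand_iff (hi : i < T.n) (hj : j < T.n) :
    Disjoint (T.strand i) (T.strand j) ↔ T.X i g ≠ T.X j g := by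
  refine ⟨fun h heq => Set.disjoint_left.1 h mid_mem_strand (heq ▸ mid_mem_strand),
    fun hne => Set.disjoint_left.2 fun p hpi hpj => hne ?_⟩
  have hij : i ≠ j := fun h => hne (by rw [h])
  have hp : p = (T.X i g, g) := inter_subset hi hj hij ⟨hpi, hpj⟩
  rw [hp] at hpj
  exact hpj.1

/-! ### Connected components of the boundary in a band -/

/-- By the finiteness of the number of strands, the pieces are relatively open and closed. -/
lemma subset_piece {A : Set Plane} (hA : IsPreconnected A) (hAS : A ⊆ bandBoundary S h H)
    {x : ℝ} (hpA : p ∈ A) (hp : p ∈ T.piece x) : A ⊆ T.piece x := by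
  set Q := ⋃ i ∈ {i | i < T.n ∧ T.X i g ≠ x}, T.strand i with hQ
  have hdisj : Disjoint (T.piece x) Q := by
    simp only [piece, hQ, disjoint_iUnion₂_left, disjoint_iUnion₂_right]
    rintro j ⟨hj, hjx⟩ i ⟨hi, rfl⟩
    exact (disjoint_strand_iff hi hj).2 hjx.symm
  have hcover : A ⊆ T.piece x ∪ Q := by
    intro q hq
    obtain ⟨i, hi, hqi⟩ := (T.mem_bandBoundary_iff q).1 (hAS hq)
    by_cases hx : T.X i g = x
    · exact .inl (mem_iUnion₂.2 ⟨i, ⟨hi, hx⟩, hqi⟩)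
    · exact .inr (mem_iUnion₂.2 ⟨i, ⟨hi, hx⟩, hqi⟩)
  have hclosed : IsClosed (T.piece x) := isClosed_biUnion_strand fun i hi => hi.1
  refine (isPreconnected_iff_subset_of_disjoint_closed.1 hA _ Q hclosed
    (isClosed_biUnion_strand fun i hi => hi.1) hcover ?_).resolve_right
      fun hAQ => Set.disjoint_left.1 hdisj hp (hAQ hpA)
  rw [hdisj.inter_eq, inter_empty]

lemma ty_eq_of_X_eq (hi : i < T.n) (hj : j < T.n) (h : T.X j g = T.X i g) : T.ty j = T.ty i := by
  by_cases hC : T.ty i = Symbol.C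
  · rw [T.single i hi hC j hj h]
  · obtain ⟨k, -, -, hk, hpair⟩ := T.pair i hi hC
    rcases (hpair j hj).1 h with rfl | rfl
    exacts [rfl, hk]

lemma ty_ne_C_of_X_eq (hi : i < T.n) (hj : j < T.n) (hij : i ≠ j) (h : T.X i g = T.X j g) :
    T.ty i ≠ Symbol.C :=
  fun hC => hij (T.single i hi hC j hj h.symm).symm

lemma piece_of_single (hi : i < T.n) (hC : T.ty i = Symbol.C) :
    T.piece (T.X i g) = T.strand i := by
  refine Subset.antisymm (iUnion₂_subset ?_) (strand_subset_piece hi)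
  rintro k ⟨hk, hki⟩
  rw [T.single i hi hC k hk hki]

lemma exists_piece_eq_union (hi : i < T.n) (hC : T.ty i ≠ Symbol.C) :
    ∃ j < T.n, i ≠ j ∧ T.X i g = T.X j g ∧ T.piece (T.X i g) = T.strand i ∪ T.strand j := by
  obtain ⟨j, hj, hji, -, hpair⟩ := T.pair i hi hC
  have hX : T.X j g = T.X i g := (hpair j hj).2 (.inr rfl)
  refine ⟨j, hj, hji.symm, hX.symm, Subset.antisymm (iUnion₂_subset ?_)
    (union_subset (strand_subset_piece hi) (hX ▸ strand_subset_piece hj))⟩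
  rintro k ⟨hk, hki⟩
  rcases (hpair k hk).1 hki with rfl | rfl
  exacts [subset_union_left, subset_union_right]

lemma isArc_strand_outer (hi : i < T.n) (hC : T.ty i ≠ Symbol.C) :
    IsArc (T.strand i) (T.X i (T.outer i), T.outer i) (T.X i g, g) := by
  rcases ty_eq_B_or_D hi hC with hB | hD
  · simpa [start, finish, outer, hB] using T.isArc_strand (i := i)
  · simpa [start, finish, outer, hD] using (T.isArc_strand (i := i)).symm

lemma hasType_union (hi : i < T.n) (hj : j < T.n) (hij : i ≠ j) (h : T.X i g = T.X j g) :
    HasType (T.strand i ∪ T.strand j) (T.ty i) := by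
  have hC := ty_ne_C_of_X_eq hi hj hij h
  have hty := ty_eq_of_X_eq hj hi h
  have harc := (isArc_strand_outer hi hC).union
    (h ▸ (isArc_strand_outer hj (hty ▸ hC)).symm) (inter_subset hi hj hij)
  have hsub := union_subset (strand_subset hi) (strand_subset hj)
  rcases ty_eq_B_or_D hi hC with hB | hD
  · rw [hB]
    simp only [outer, ← hty, hB, if_true] at harc
    exact ⟨_, _, harc, rfl, fun x hx => (hsub hx).2.1⟩
  · rw [hD]
    simp only [outer, ← hty, hD, reduceCtorEq, if_false] at harc
    exact ⟨_, _, harc, rfl, fun x hx => (hsub hx).2.2⟩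

lemma hasType_piece (hi : i < T.n) : HasType (T.piece (T.X i g)) (T.ty i) := by
  by_cases hC : T.ty i = Symbol.C
  · rw [piece_of_single hi hC, hC]
    exact isCrossing_strand
  · obtain ⟨j, hj, hij, hX, hpiece⟩ := exists_piece_eq_union hi hC
    rw [hpiece]
    exact hasType_union hi hj hij hX

lemma connectedComponentIn_eq (hi : i < T.n) :
    connectedComponentIn (bandBoundary S h H) (T.X i g, g) = T.piece (T.X i g) := by
  have hmid : ((T.X i g, g) : Plane) ∈ T.piece (T.X i g) := strand_subset_piece hi mid_mem_strand
  refine Subset.antisymm ?_ (IsPreconnected.subset_connectedComponentIn ?_ hmid (piece_subset _))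
  · exact subset_piece isPreconnected_connectedComponentIn (connectedComponentIn_subset _ _)
      (mem_connectedComponentIn (piece_subset _ hmid)) hmid
  · refine isPreconnected_of_forall (T.X i g, g) fun q hq => ?_
    obtain ⟨k, ⟨hk, hki⟩, hqk⟩ := mem_iUnion₂.1 hq
    exact ⟨T.strand k, hki ▸ strand_subset_piece hk, hki ▸ mid_mem_strand, hqk,
      isArc_strand.isPreconnected⟩

lemma hasComponentType_strand (hi : i < T.n) :
    HasComponentType S h H (T.strand i) (T.ty i) :=
  ⟨_, mid_mem_strand, by rw [connectedComponentIn_eq hi]; exact hasType_piece hi⟩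

/-! ### Crossing components of a band -/

lemma eq_mid_of_mem_piece {x : ℝ} (hp : p ∈ T.piece x) (hpg : p.2 = g) : p = (x, g) := by
  obtain ⟨i, ⟨-, rfl⟩, hpi⟩ := mem_iUnion₂.1 hp
  exact Prod.ext (hpg ▸ hpi.1) hpg

/-- The height has a maximum or a minimum on the piece at the critical level, so a crossing arc can
reach this level only at one of its ends. -/
lemma mid_eq_end_of_mem {A : Set Plane} {q : Plane} (hi : i < T.n) (hC : T.ty i ≠ Symbol.C)
    (hA : IsArc A p q) (hrange : ∀ x ∈ A, p.2 ≤ x.2 ∧ x.2 ≤ q.2) (hsub : A ⊆ T.piece (T.X i g))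
    (hmid : (T.X i g, g) ∈ A) : (T.X i g, g) = p ∨ (T.X i g, g) = q := by
  obtain ⟨k, ⟨hk, hki⟩, hpk⟩ := mem_iUnion₂.1 (hsub hA.left_mem)
  obtain ⟨l, ⟨hl, hli⟩, hql⟩ := mem_iUnion₂.1 (hsub hA.right_mem)
  rcases ty_eq_B_or_D hi hC with hB | hD
  · have hqg : q.2 ≤ g := hql.2.2.trans (if_pos ((ty_eq_of_X_eq hi hl hli).trans hB)).le
    exact .inr (eq_mid_of_mem_piece (hsub hA.right_mem) (hqg.antisymm (hrange _ hmid).2)).symm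
  · have hpg : g ≤ p.2 := (if_pos ((ty_eq_of_X_eq hi hk hki).trans hD)).ge.trans hpk.2.1
    exact .inl (eq_mid_of_mem_piece (hsub hA.left_mem) ((hrange _ hmid).1.antisymm hpg)).symm

lemma exists_subset_strand (T : Strip S h g H) {A : Set Plane} (hA : IsCrossing A)
    (hAS : A ⊆ bandBoundary S h H) : ∃ i < T.n, A ⊆ T.strand i := by
  obtain ⟨p, q, hpq, hrange⟩ := hA
  obtain ⟨i, hi, hpi⟩ := (T.mem_bandBoundary_iff p).1 (hAS hpq.left_mem)
  have hsub := subset_piece hpq.isPreconnected hAS hpq.left_mem (strand_subset_piece hi hpi)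
  by_cases hC : T.ty i = Symbol.C
  · exact ⟨i, hi, by rwa [piece_of_single hi hC] at hsub⟩
  · obtain ⟨j, hj, hij, -, hpiece⟩ := exists_piece_eq_union hi hC
    rcases hpq.subset_or_subset isClosed_strand isClosed_strand (hpiece ▸ hsub)
      (inter_subset hi hj hij) (mid_eq_end_of_mem hi hC hpq hrange hsub) with h | h
    exacts [⟨i, hi, h⟩, ⟨j, hj, h⟩]

lemma eq_of_strand_subset (hi : i < T.n) (hj : j < T.n) (hsub : T.strand i ⊆ T.strand j) :
    i = j := by
  by_contra hij
  have hmid : T.strand i ⊆ {(T.X i g, g)} :=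
    (subset_inter Subset.rfl hsub).trans (inter_subset hi hj hij)
  have hends := (hmid isArc_strand.left_mem).trans (hmid isArc_strand.right_mem).symm
  exact T.start_lt_finish.ne (Prod.ext_iff.1 hends).2

lemma injOn_strand : InjOn T.strand (Iio T.n) :=
  fun _ hi _ hj h => eq_of_strand_subset hi hj h.le

lemma isCrossingComponent_iff {A : Set Plane} :
    IsCrossingComponent S h H A ↔ ∃ i < T.n, T.strand i = A := by
  constructor
  · rintro ⟨hAS, hA, hmax⟩
    obtain ⟨i, hi, hAi⟩ := T.exists_subset_strand hA hAS
    exact ⟨i, hi, hmax _ hAi (strand_subset hi) isCrossing_strand⟩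
  · rintro ⟨i, hi, rfl⟩
    refine ⟨strand_subset hi, isCrossing_strand, fun A hiA hAS hA => ?_⟩
    obtain ⟨j, hj, hAj⟩ := T.exists_subset_strand hA hAS
    obtain rfl := eq_of_strand_subset hi hj (hiA.trans hAj)
    exact hAj.antisymm hiA

lemma finite_setOf_isCrossingComponent (T : Strip S h g H) :
    {A | IsCrossingComponent S h H A}.Finite :=
  ((finite_Iio T.n).image T.strand).subset fun _ hA => T.isCrossingComponent_iff.1 hA

/-! ### The order of the crossing components -/

lemma mem_strand_of_isEnd (hp : IsEnd (T.strand i) p) : p ∈ T.strand i :=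
  hp.choose_spec.left_mem

lemma endPosition_lt_endPosition (hi : i < T.n) {c : ℝ}
    (hendi : IsEnd (T.strand i) (T.X i c, c)) (hendj : IsEnd (T.strand j) (T.X j c, c))
    (hlt : T.X i c < T.X j c) :
    endPosition S h H c (T.strand i) < endPosition S h H c (T.strand j) := by
  refine ncard_lt_ncard ((ssubset_iff_of_subset ?_).2 ⟨T.strand i, ?_, ?_⟩)
    (T.finite_setOf_isCrossingComponent.subset fun A hA => hA.1)
  · rintro A ⟨hA, p, q, hp, rfl, hq, hqc, hqp⟩
    exact ⟨hA, _, q, hendj, rfl, hq, hqc, (hqp.trans_eq (mem_strand_of_isEnd hp).1).trans hlt⟩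
  · exact ⟨isCrossingComponent_iff.2 ⟨i, hi, rfl⟩, _, _, hendj, rfl, hendi, rfl, hlt⟩
  · rintro ⟨-, p, q, hp, rfl, hq, hqc, hqp⟩
    rw [(mem_strand_of_isEnd hp).1, (mem_strand_of_isEnd hq).1, hqc] at hqp
    exact hqp.false

lemma endPosition_eq_zero {c : ℝ} (hc : ∀ p ∈ T.strand i, p.2 ≠ c) :
    endPosition S h H c (T.strand i) = 0 := by
  refine (congrArg ncard (eq_empty_of_forall_notMem ?_)).trans (ncard_empty _)
  rintro A ⟨-, p, -, hp, hpc, -⟩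
  exact hc p (mem_strand_of_isEnd hp) hpc

lemma upperPosition_eq_zero (hB : T.ty i = Symbol.B) : upperPosition S h H (T.strand i) = 0 :=
  endPosition_eq_zero fun _ hp => ((hp.2.2.trans (if_pos hB).le).trans_lt T.mid_lt).ne

lemma lowerPosition_eq_zero (hD : T.ty i = Symbol.D) : lowerPosition S h H (T.strand i) = 0 :=
  endPosition_eq_zero fun _ hp => (T.lt_mid.trans_le ((if_pos hD).ge.trans hp.2.1)).ne'

lemma outer_ne_mid : T.outer i ≠ g := by
  unfold outer
  split_ifs
  exacts [T.lt_mid.ne, T.mid_lt.ne']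

lemma endPosition_outer_lt (hj : j < T.n) (hij : i < j) (hX : T.X i g = T.X j g) :
    endPosition S h H (T.outer i) (T.strand i) < endPosition S h H (T.outer i) (T.strand j) := by
  have hi := hij.trans hj
  have hC := ty_ne_C_of_X_eq hi hj hij.ne hX
  have hty := ty_eq_of_X_eq hj hi hX
  have hiarc := isArc_strand_outer hi hC
  have hjarc := isArc_strand_outer hj (hty ▸ hC)
  rw [show T.outer j = T.outer i by simp only [outer, hty]] at hjarc
  exact endPosition_lt_endPosition hi ⟨_, hiarc⟩ ⟨_, hjarc⟩
    (T.X_lt i j hij hj _ hiarc.left_mem _ hjarc.left_mem rfl outer_ne_mid)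

lemma leftOf_iff_of_X_eq (hi : i < T.n) (hj : j < T.n) (hij : i ≠ j) (hX : T.X i g = T.X j g) :
    LeftOf S h H g (T.strand i) (T.strand j) ↔
      endPosition S h H (T.outer i) (T.strand i) < endPosition S h H (T.outer i) (T.strand j) := by
  have hunion := hasType_union hi hj hij hX
  have hty := ty_eq_of_X_eq hj hi hX
  have hmeet : ¬ Disjoint (T.strand i) (T.strand j) := by simp [disjoint_strand_iff hi hj, hX]
  rcases ty_eq_B_or_D hi (ty_ne_C_of_X_eq hi hj hij hX) with hB | hD
  · have hbirth : IsBirth (T.strand i ∪ T.strand j) := by rwa [hB] at hunion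
    simp [LeftOf, hmeet, hbirth, upperPosition_eq_zero hB, upperPosition_eq_zero (hty ▸ hB),
      lowerPosition, outer, hB]
  · have hdeath : IsDeath (T.strand i ∪ T.strand j) := by rwa [hD] at hunion
    simp [LeftOf, hmeet, hdeath, lowerPosition_eq_zero hD, lowerPosition_eq_zero (hty ▸ hD),
      upperPosition, outer, hD]

lemma leftOf_iff_of_X_ne (hi : i < T.n) (hj : j < T.n) (hX : T.X i g ≠ T.X j g) :
    LeftOf S h H g (T.strand i) (T.strand j) ↔ T.X i g < T.X j g := by
  have hdisj := (disjoint_strand_iff hi hj).2 hX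
  constructor
  · rintro (h | h | h)
    exacts [h.2 _ mid_mem_strand _ mid_mem_strand rfl rfl, absurd hdisj h.1, absurd hdisj h.1]
  · refine fun hlt => .inl ⟨hdisj, fun p hp q hq hpg hqg => ?_⟩
    rwa [hp.1, hq.1, hpg, hqg]

lemma leftOf_iff (hi : i < T.n) (hj : j < T.n) :
    LeftOf S h H g (T.strand i) (T.strand j) ↔ i < j := by
  rcases eq_or_ne i j with rfl | hij
  · have hmeet : ¬ Disjoint (T.strand i) (T.strand i) := (disjoint_strand_iff hi hi).not.2 (by simp)
    simp only [LeftOf, hmeet, lt_irrefl, false_and, and_false, or_false]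
  by_cases hX : T.X i g = T.X j g
  · rw [leftOf_iff_of_X_eq hi hj hij hX]
    refine ⟨fun hlt => hij.lt_of_le (not_lt.1 fun hji => ?_), fun h => endPosition_outer_lt hj h hX⟩
    have houter : T.outer j = T.outer i := by simp only [outer, ty_eq_of_X_eq hi hj hX.symm]
    exact hlt.asymm (houter ▸ endPosition_outer_lt hi hji hX.symm)
  · rw [leftOf_iff_of_X_ne hi hj hX]
    exact ⟨fun hlt => hij.lt_of_le (not_lt.1 fun hji => (T.X_mid_le j i hji hi).not_gt hlt),
      fun h => (T.X_mid_le i j h hj).lt_of_ne hX⟩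

lemma position_strand (hj : j < T.n) : position S h H g (T.strand j) = j := by
  have heq : {A | IsCrossingComponent S h H A ∧ LeftOf S h H g A (T.strand j)} =
      T.strand '' Iio j := by
    ext A
    constructor
    · rintro ⟨hA, hleft⟩
      obtain ⟨i, hi, rfl⟩ := T.isCrossingComponent_iff.1 hA
      exact ⟨i, (leftOf_iff hi hj).1 hleft, rfl⟩
    · rintro ⟨i, hij, rfl⟩
      have hi : i < T.n := lt_trans hij hj
      exact ⟨T.isCrossingComponent_iff.2 ⟨i, hi, rfl⟩, (leftOf_iff hi hj).2 hij⟩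
  rw [position, heq, (injOn_strand.mono (Iio_subset_Iio hj.le)).ncard_image, ncard_Iio_nat]

lemma isCriptString (T : Strip S h g H) :
    IsCriptString S h H ((List.range T.n).map T.ty) := by
  refine ⟨T.isUnicritical, g, ⟨T.lt_mid, T.mid_lt⟩, T.eq_mid, (List.range T.n).map T.strand,
    fun A => ?_, ?_, ?_⟩
  · simp [T.isCrossingComponent_iff]
  · rw [List.pairwise_map]
    refine List.pairwise_lt_range.imp_of_mem fun hi hj hij => ?_
    rwa [position_strand (List.mem_range.1 hi), position_strand (List.mem_range.1 hj)]
  · rw [List.forall₂_map_left_iff, List.forall₂_map_right_iff, List.forall₂_same]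
    exact fun i hi => hasComponentType_strand (List.mem_range.1 hi)

end Strip

/-! ### Pairs of layers -/

/-- The letters of the components with strands in the lower half of a band. -/
def Symbol.reachesBot : Symbol → Bool
  | .B | .C => true
  | .D | .sep => false

/-- The letters of the components with strands in the upper half of a band. -/
def Symbol.reachesTop : Symbol → Bool
  | .C | .D => true
  | .B | .sep => false

lemma mem_strandSet_iff {h g H : ℝ} {t : Symbol} {X : ℝ → ℝ} {p : Plane} (hg : h ≤ g) (hH : g ≤ H)
    (ht : t ≠ .sep) : p ∈ strandSet h g H t X ↔
      (t.reachesBot ∧ h ≤ p.2 ∧ p.2 ≤ g ∧ p.1 = X p.2) ∨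
        (t.reachesTop ∧ g ≤ p.2 ∧ p.2 ≤ H ∧ p.1 = X p.2) := by
  cases t <;> simp [strandSet, Symbol.reachesBot, Symbol.reachesTop] at ht ⊢ <;> grind

lemma card_filter_eq_le_one {ι α : Type*} [DecidableEq α] {s : Finset ι} {f : ι → α}
    (hf : InjOn f s) (a : α) : #{i ∈ s | f i = a} ≤ 1 := by
  refine Finset.card_le_one.2 fun i hi j hj => ?_
  simp only [Finset.mem_filter] at hi hj
  exact hf hi.1 hj.1 (hi.2.trans hj.2.symm)

namespace LayeredDrawing

variable {D : LayeredDrawing} {t : ℤ} {i j : ℕ} {p q : Plane}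

/-- The abscissa at the height `y` of the union of the strands `i` of the layers `t` and `t + 1`,
for strands with a common end. -/
noncomputable def doubleX (D : LayeredDrawing) (t : ℤ) (i : ℕ) (y : ℝ) : ℝ :=
  if y ≤ t + 1 then D.X t i y else D.X (t + 1) i y

/-- The union of the strands `i` of the layers `t` and `t + 1`. -/
def doubleSeg (D : LayeredDrawing) (t : ℤ) (i : ℕ) : Set Plane :=
  {p | (i ∈ D.strands t ∧ p ∈ D.seg (t, i)) ∨ (i ∈ D.strands (t + 1) ∧ p ∈ D.seg (t + 1, i))}

lemma doubleX_of_le {y : ℝ} (hy : y ≤ t + 1) : D.doubleX t i y = D.X t i y := if_pos hy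

lemma doubleX_mid : D.doubleX t i (t + 1) = D.top t i := by
  rw [doubleX_of_le le_rfl, X_top]

lemma X_add_one : D.X (t + 1) i (t + 1) = D.bot (t + 1) i := by
  simpa using D.X_bot (t + 1) i

lemma doubleX_of_ge (hjoin : D.top t i = D.bot (t + 1) i) {y : ℝ} (hy : t + 1 ≤ y) :
    D.doubleX t i y = D.X (t + 1) i y := by
  rcases hy.eq_or_lt with rfl | hy
  · rw [doubleX_mid, X_add_one, hjoin]
  · exact if_neg (not_le.2 hy)

lemma continuous_doubleX (hjoin : D.top t i = D.bot (t + 1) i) : Continuous (D.doubleX t i) :=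
  (continuous_X t i).if_le (continuous_X (t + 1) i) continuous_id continuous_const fun y hy => by
    obtain rfl : y = t + 1 := hy
    rw [X_top, X_add_one, hjoin]

lemma strandSet_doubleX {a : Symbol} (ha : a ≠ .sep) (hjoin : D.top t i = D.bot (t + 1) i)
    (hbot : i ∈ D.strands t ↔ a.reachesBot) (htop : i ∈ D.strands (t + 1) ↔ a.reachesTop) :
    strandSet t (t + 1) (t + 2) a (D.doubleX t i) = D.doubleSeg t i := by
  ext p
  rw [mem_strandSet_iff (by linarith) (by linarith) ha, ← hbot, ← htop]
  simp only [doubleSeg, seg, Set.mem_ofPred_eq, Int.cast_add, Int.cast_one, add_assoc,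
    one_add_one_eq_two]
  refine or_congr (and_congr_right fun _ => and_congr_right fun _ => and_congr_right fun hle => ?_)
    (and_congr_right fun _ => and_congr_right fun hge => and_congr_right fun _ => ?_)
  · rw [doubleX_of_le hle]
  · rw [doubleX_of_ge hjoin hge]

lemma IsSimpleLevel.bot_lt_bot (ht : D.IsSimpleLevel t) (hi : i ∈ D.strands t)
    (hj : j ∈ D.strands t) (hij : i < j) : D.bot t i < D.bot t j :=
  (D.ordered t i hi j hj hij).1.lt_of_ne fun h => hij.ne (ht.1 hi hj h)

lemma IsSimpleLevel.top_lt_top (ht : D.IsSimpleLevel (t + 1)) (hi : i ∈ D.strands t)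
    (hj : j ∈ D.strands t) (hij : i < j) : D.top t i < D.top t j := by
  have hinj := ht.2
  rw [add_sub_cancel_right] at hinj
  exact (D.ordered t i hi j hj hij).2.1.lt_of_ne fun h => hij.ne (hinj hi hj h)

lemma fst_lt_fst_of_mem_doubleSeg (ht : D.IsSimpleLevel t) (ht' : D.IsSimpleLevel (t + 1 + 1))
    (hij : i < j) (hp : p ∈ D.doubleSeg t i) (hq : q ∈ D.doubleSeg t j) (hpq : p.2 = q.2)
    (hmid : p.2 ≠ t + 1) : p.1 < q.1 := by
  rcases hp with ⟨hi, h0, h1, hX⟩ | ⟨hi, h0, h1, hX⟩ <;>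
    rcases hq with ⟨hj, h0', h1', hX'⟩ | ⟨hj, h0', h1', hX'⟩ <;>
    push_cast at h0 h1 h0' h1'
  · rw [hX, hX', ← hpq]
    exact X_lt_X_of_bot_lt (ht.bot_lt_bot hi hj hij) (D.ordered t i hi j hj hij).2.1
      ⟨h0, h1.lt_of_ne hmid⟩
  · exact absurd (h1.antisymm (hpq ▸ h0')) hmid
  · exact absurd ((hpq ▸ h1').antisymm h0) hmid
  · rw [hX, hX', ← hpq]
    exact X_lt_X_of_top_lt (D.ordered _ i hi j hj hij).1 (ht'.top_lt_top hi hj hij)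
      ⟨by push_cast; exact h0.lt_of_ne' hmid, by push_cast; exact h1⟩

lemma IsSimpleLevel.exists_bot_eq_iff (ht : D.IsSimpleLevel t) (v : ℝ) :
    (∃ i ∈ D.strands t, D.bot t i = v) ↔ ∃ i ∈ D.strands (t - 1), D.top (t - 1) i = v := by
  have hbot := card_filter_eq_le_one ht.1 v
  have htop := card_filter_eq_le_one ht.2 v
  have hdegree := D.degree t v
  rw [← Finset.filter_nonempty_iff, ← Finset.filter_nonempty_iff, ← Finset.card_pos,
    ← Finset.card_pos]
  omega

lemma IsSimpleLevel.exists_mem_seg_ge (ht : D.IsSimpleLevel t) (hp : p ∈ D.curve)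
    (h : t ≤ p.2) : ∃ s ≥ t, ∃ i ∈ D.strands s, p ∈ D.seg (s, i) := by
  obtain ⟨s, i, hi, h0, h1, hX⟩ := mem_curve.1 hp
  rcases le_or_gt t s with hts | hst
  · exact ⟨s, hts, i, hi, h0, h1, hX⟩
  obtain rfl : s = t - 1 := by
    have : (t : ℝ) ≤ s + 1 := h.trans h1
    norm_cast at this
    omega
  have hpt : p.2 = t := le_antisymm (by simpa using h1) h
  obtain ⟨j, hj, hbot⟩ := (ht.exists_bot_eq_iff _).2 ⟨i, hi, rfl⟩
  exact ⟨t, le_rfl, j, hj, h, by simp [hpt], by simp [hX, hpt, hbot]⟩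

lemma IsSimpleLevel.exists_mem_seg_le (ht : D.IsSimpleLevel (t + 1)) (hp : p ∈ D.curve)
    (h : p.2 ≤ t + 1) : ∃ s ≤ t, ∃ i ∈ D.strands s, p ∈ D.seg (s, i) := by
  obtain ⟨s, i, hi, h0, h1, hX⟩ := mem_curve.1 hp
  rcases le_or_gt s t with hst | hts
  · exact ⟨s, hst, i, hi, h0, h1, hX⟩
  obtain rfl : s = t + 1 := by
    have : (s : ℝ) ≤ t + 1 := h0.trans h
    norm_cast at this
    omega
  have hpt : p.2 = t + 1 := le_antisymm h (by simpa using h0)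
  obtain ⟨j, hj, htop⟩ := (ht.exists_bot_eq_iff _).1 ⟨i, hi, rfl⟩
  rw [add_sub_cancel_right] at hj htop
  exact ⟨t, le_rfl, j, hj, by simp [hpt], h, by simp [hX, hpt, htop, X_add_one]⟩

lemma mem_bandBoundary_region_iff (ht : D.IsSimpleLevel t) (ht' : D.IsSimpleLevel (t + 1 + 1)) :
    p ∈ bandBoundary D.region t (t + 2) ↔ ∃ i, p ∈ D.doubleSeg t i := by
  rw [bandBoundary, frontier_region, Set.mem_ofPred_eq]
  constructor
  · rintro ⟨hp, h0, h2⟩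
    obtain ⟨s, i, hi, hps, hs⟩ :
        ∃ s, ∃ i ∈ D.strands s, p ∈ D.seg (s, i) ∧ (s = t ∨ s = t + 1) := by
      rcases h0.eq_or_lt with h0 | h0
      · obtain ⟨s, hts, i, hi, hps⟩ := ht.exists_mem_seg_ge hp h0.le
        have : (s : ℝ) ≤ t := h0 ▸ hps.1
        norm_cast at this
        exact ⟨s, i, hi, hps, by omega⟩
      · obtain ⟨s, hst, i, hi, hps⟩ := ht'.exists_mem_seg_le hp (by push_cast; linarith)
        have : (t : ℝ) < s + 1 := h0.trans_le hps.2.1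
        norm_cast at this
        exact ⟨s, i, hi, hps, by omega⟩
    rcases hs with rfl | rfl
    exacts [⟨i, .inl ⟨hi, hps⟩⟩, ⟨i, .inr ⟨hi, hps⟩⟩]
  · rintro ⟨i, ⟨hi, hp⟩ | ⟨hi, hp⟩⟩ <;> refine ⟨mem_biUnion (x := (_, i)) hi hp, ?_, ?_⟩ <;>
      have := hp.1 <;> have := hp.2.1 <;> push_cast at * <;> linarith

lemma eq_add_one_of_isCritical (ht : D.IsSimpleLevel t) (ht' : D.IsSimpleLevel (t + 1 + 1)) {c : ℝ}
    (hc : c ∈ Icc (t : ℝ) (t + 2)) (hcrit : IsCritical (frontier D.region) c) : c = t + 1 := by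
  rw [frontier_region] at hcrit
  have hlow : c ∉ Ioo (t : ℝ) (t + 1) := fun h => not_isCritical_of_mem_Ioo h hcrit
  have hup : c ∉ Ioo ((t + 1 : ℤ) : ℝ) ((t + 1 : ℤ) + 1) :=
    fun h => not_isCritical_of_mem_Ioo h hcrit
  have ht_ne : c ≠ t := by
    rintro rfl
    exact ht.not_isCritical hcrit
  have ht'_ne : c ≠ ((t + 1 + 1 : ℤ) : ℝ) := by
    rintro rfl
    exact ht'.not_isCritical hcrit
  push_cast [mem_Ioo] at *
  grind

lemma isUnicritical_region (ht : D.IsSimpleLevel t) (ht' : D.IsSimpleLevel (t + 1 + 1)) :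
    IsUnicritical D.region t (t + 2) := by
  have hcrit := ht'.not_isCritical
  rw [show ((t + 1 + 1 : ℤ) : ℝ) = t + 2 by push_cast; ring] at hcrit
  rw [IsUnicritical, frontier_region]
  refine ⟨by linarith, ht.not_isCritical, hcrit, fun c hc d hd => ?_⟩
  rw [← frontier_region] at hc hd
  rw [eq_add_one_of_isCritical ht ht' hc.1 hc.2, eq_add_one_of_isCritical ht ht' hd.1 hd.2]

end LayeredDrawing

/-! ### Places of letters -/

/-- The letters to which the evenness conditions apply. -/
def Symbol.IsPaired (t : Symbol) : Prop := t = .B ∨ t = .D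

instance : DecidablePred Symbol.IsPaired := fun _ => instDecidableOr

/-- The symbol at the place `i`, with `sep` as the value outside the word. -/
def letter (u : List Symbol) (i : ℕ) : Symbol := u.getD i .sep

/-- The places of the letters with the property `P`. -/
def places (P : Symbol → Bool) (u : List Symbol) : Finset ℕ :=
  {i ∈ Finset.range u.length | P (letter u i)}

section Places

variable {u : List Symbol} {P : Symbol → Bool} {t : Symbol} {i j k : ℕ}

lemma letter_eq_getElem (hi : i < u.length) : letter u i = u[i] :=
  List.getD_eq_getElem _ _ hi

lemma letter_eq_iff (ht : t ≠ .sep) : letter u i = t ↔ u[i]? = some t := by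
  rw [letter, List.getD_eq_getElem?_getD]
  cases u[i]? <;> simp [ht.symm]

lemma lt_length_of_letter_ne_sep (h : letter u i ≠ .sep) : i < u.length := by
  by_contra hi
  exact h (List.getD_eq_default _ _ (not_lt.1 hi))

lemma letter_ne_sep (hu : .sep ∉ u) (hi : i < u.length) : letter u i ≠ .sep := by
  rw [letter_eq_getElem hi]
  exact fun h => hu (h ▸ List.getElem_mem hi)

lemma map_letter_range (u : List Symbol) : (List.range u.length).map (letter u) = u :=
  List.ext_getElem (by simp) fun i _ hi => by simp [letter_eq_getElem hi]

lemma mem_places : i ∈ places P u ↔ i < u.length ∧ P (letter u i) := by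
  simp [places]

lemma findIdxNth_countPBefore (hi : i ∈ places P u) :
    u.findIdxNth P (u.countPBefore P i) = i := by
  obtain ⟨hlt, hP⟩ := mem_places.1 hi
  exact List.findIdxNth_countPBefore_of_lt_length_of_pos (letter_eq_getElem hlt ▸ hP)

lemma injOn_countPBefore : InjOn (u.countPBefore P) (places P u) :=
  LeftInvOn.injOn fun _ => findIdxNth_countPBefore

lemma countPBefore_lt_countPBefore (hi : i ∈ places P u) (hj : j ∈ places P u) (hij : i < j) :
    u.countPBefore P i < u.countPBefore P j :=
  (List.countPBefore_mono hij.le).lt_of_ne fun h => hij.ne (injOn_countPBefore hi hj h)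

lemma image_countPBefore :
    (places P u).image (u.countPBefore P) = Finset.range (u.countP P) := by
  ext n
  simp only [Finset.mem_image, Finset.mem_range]
  constructor
  · rintro ⟨i, hi, rfl⟩
    obtain ⟨hlt, hP⟩ := mem_places.1 hi
    exact List.countPBefore_lt_countP_of_lt_length_of_pos (letter_eq_getElem hlt ▸ hP)
  · intro hn
    have hlt := List.findIdxNth_lt_length_of_lt_countP hn
    exact ⟨u.findIdxNth P n,
      mem_places.2 ⟨hlt, letter_eq_getElem hlt ▸ List.pos_findIdxNth_getElem⟩,
      List.countPBefore_findIdxNth_of_lt_countP hn⟩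

lemma card_filter_countPBefore (Q : ℕ → Prop) [DecidablePred Q] :
    #{i ∈ places P u | Q (u.countPBefore P i)} = #{n ∈ Finset.range (u.countP P) | Q n} := by
  rw [← image_countPBefore, Finset.filter_image, Finset.card_image_of_injOn]
  exact injOn_countPBefore.mono (Finset.coe_subset.2 (Finset.filter_subset _ _))

lemma countP_reachesBot (u : List Symbol) :
    u.countP Symbol.reachesBot = u.count .B + u.count .C := by
  induction u with
  | nil => rfl
  | cons a u ih => cases a <;> simp [List.countP_cons, Symbol.reachesBot, ih] <;> omega

lemma countP_reachesTop (u : List Symbol) :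
    u.countP Symbol.reachesTop = u.count .D + u.count .C := by
  induction u with
  | nil => rfl
  | cons a u ih => cases a <;> simp [List.countP_cons, Symbol.reachesTop, ih] <;> omega

/-! ### Pairs of letters -/

/-- The letter at the place `i` is the second one of a pair `BB` or `DD`. -/
def IsSecond (u : List Symbol) (i : ℕ) : Prop :=
  (letter u i).IsPaired ∧ Odd ((u.take i).count (letter u i))

open Classical in
/-- The position of the letter at the place `i` on the critical level, where the strands of a pair
meet at the place of the first of its letters. -/
noncomputable def midPos (u : List Symbol) (i : ℕ) : ℕ := if IsSecond u i then i - 1 else i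

lemma count_take_succ {α : Type*} [DecidableEq α] (u : List α) (t : α) (i : ℕ) :
    (u.take (i + 1)).count t = (u.take i).count t + if u[i]? = some t then 1 else 0 := by
  rw [List.take_add_one, List.count_append]
  cases u[i]? <;> simp [List.count_singleton]

lemma Symbol.IsPaired.ne_sep (ht : t.IsPaired) : t ≠ .sep := by
  rintro rfl
  simp [IsPaired] at ht

lemma EvennessConditions.evennessFor (hu : EvennessConditions u) (ht : t.IsPaired) :
    EvennessFor t u := by
  rcases ht with rfl | rfl
  exacts [hu.1, hu.2]

lemma EvennessFor.exists_of_odd (hu : EvennessFor t u) (hodd : Odd ((u.take i).count t)) :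
    ∃ k, i = k + 1 ∧ u[k]? = some t ∧ Even ((u.take k).count t) := by
  induction i with
  | zero => simp at hodd
  | succ k ih =>
    rw [count_take_succ] at hodd
    split_ifs at hodd with hk
    · exact ⟨k, rfl, hk, Nat.not_odd_iff_even.1 (Nat.odd_add_one.1 hodd)⟩
    · obtain ⟨l, rfl, hl, heven⟩ := ih hodd
      exact absurd (hu l hl heven) hk

lemma EvennessFor.even_count (hu : EvennessFor t u) : Even (u.count t) := by
  by_contra hodd
  rw [Nat.not_even_iff_odd, ← List.take_length (l := u)] at hodd
  obtain ⟨k, hk, hkt, heven⟩ := hu.exists_of_odd hodd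
  simpa [← hk] using hu k hkt heven

lemma EvennessConditions.exists_of_isSecond (hu : EvennessConditions u) (hi : IsSecond u i) :
    ∃ k, i = k + 1 ∧ letter u k = letter u i ∧ ¬ IsSecond u k := by
  obtain ⟨hpaired, hodd⟩ := hi
  obtain ⟨k, rfl, hk, heven⟩ := (hu.evennessFor hpaired).exists_of_odd hodd
  have hletter := (letter_eq_iff hpaired.ne_sep).2 hk
  exact ⟨k, rfl, hletter, fun h => Nat.not_odd_iff_even.2 (hletter ▸ heven) h.2⟩

lemma EvennessConditions.letter_succ (hu : EvennessConditions u) (hi : ¬ IsSecond u i)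
    (hpaired : (letter u i).IsPaired) : letter u (i + 1) = letter u i ∧ IsSecond u (i + 1) := by
  have heven : Even ((u.take i).count (letter u i)) :=
    Nat.not_odd_iff_even.1 fun hodd => hi ⟨hpaired, hodd⟩
  have hget := (letter_eq_iff hpaired.ne_sep).1 rfl
  have hsucc : letter u (i + 1) = letter u i :=
    (letter_eq_iff hpaired.ne_sep).2 (hu.evennessFor hpaired i hget heven)
  refine ⟨hsucc, hsucc ▸ hpaired, ?_⟩
  rw [hsucc, count_take_succ, if_pos hget]
  exact heven.add_one

lemma midPos_of_isSecond (hi : IsSecond u i) : midPos u i = i - 1 := if_pos hi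

lemma midPos_of_not_isSecond (hi : ¬ IsSecond u i) : midPos u i = i := if_neg hi

lemma midPos_le : midPos u i ≤ i := by
  unfold midPos
  split_ifs <;> omega

lemma midPos_mono : Monotone (midPos u) := by
  refine monotone_nat_of_le_succ fun i => ?_
  unfold midPos
  split_ifs <;> omega

lemma EvennessConditions.of_midPos_eq (hu : EvennessConditions u) (hij : i < j)
    (h : midPos u i = midPos u j) : j = i + 1 ∧ ¬ IsSecond u i ∧ (letter u i).IsPaired := by
  have hle : midPos u i ≤ i := midPos_le
  have hj : IsSecond u j := by
    by_contra hj
    rw [midPos_of_not_isSecond hj] at h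
    omega
  obtain ⟨k, rfl, hletter, hk⟩ := hu.exists_of_isSecond hj
  rw [midPos_of_isSecond hj] at h
  obtain rfl : i = k := by omega
  exact ⟨rfl, hk, hletter ▸ hj.1⟩

lemma EvennessConditions.eq_or_of_midPos_eq (hu : EvennessConditions u)
    (h : midPos u k = midPos u i) :
    k = i ∨ (k = i + 1 ∧ ¬ IsSecond u i ∧ (letter u i).IsPaired) ∨
      (i = k + 1 ∧ ¬ IsSecond u k ∧ (letter u k).IsPaired) := by
  rcases lt_trichotomy k i with hki | rfl | hik
  exacts [.inr (.inr (hu.of_midPos_eq hki h)), .inl rfl,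
    .inr (.inl (hu.of_midPos_eq hik h.symm))]

lemma EvennessConditions.midPos_eq_iff_of_not_isPaired (hu : EvennessConditions u)
    (hi : ¬ (letter u i).IsPaired) : midPos u k = midPos u i ↔ k = i := by
  refine ⟨fun h => ?_, fun h => h ▸ rfl⟩
  rcases hu.eq_or_of_midPos_eq h with rfl | ⟨-, -, hpaired⟩ | ⟨rfl, hk, hpaired⟩
  · rfl
  · exact absurd hpaired hi
  · exact absurd ((hu.letter_succ hk hpaired).1 ▸ hpaired) hi

lemma EvennessConditions.midPos_eq_iff_of_first (hu : EvennessConditions u) (hi : ¬ IsSecond u i)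
    (hpaired : (letter u i).IsPaired) : midPos u k = i ↔ k = i ∨ k = i + 1 := by
  have hmid := midPos_of_not_isSecond hi
  have hsecond := (hu.letter_succ hi hpaired).2
  constructor
  · intro h
    rcases hu.eq_or_of_midPos_eq (h.trans hmid.symm) with rfl | ⟨rfl, -⟩ | ⟨rfl, hk, -⟩
    · exact .inl rfl
    · exact .inr rfl
    · rw [midPos_of_not_isSecond hk] at h
      omega
  · rintro (rfl | rfl)
    exacts [hmid, midPos_of_isSecond hsecond]

lemma EvennessConditions.exists_midPos_eq_iff (hu : EvennessConditions u)
    (hpaired : (letter u i).IsPaired) :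
    ∃ j, j ≠ i ∧ letter u j = letter u i ∧ ∀ k, midPos u k = midPos u i ↔ k = i ∨ k = j := by
  by_cases hi : IsSecond u i
  · obtain ⟨j, rfl, hletter, hj⟩ := hu.exists_of_isSecond hi
    refine ⟨j, by omega, hletter, fun k => ?_⟩
    rw [midPos_of_isSecond hi, add_tsub_cancel_right,
      hu.midPos_eq_iff_of_first hj (hletter ▸ hpaired), or_comm]
  · refine ⟨i + 1, by omega, (hu.letter_succ hi hpaired).1, fun k => ?_⟩
    rw [midPos_of_not_isSecond hi, hu.midPos_eq_iff_of_first hi hpaired]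

lemma EvennessConditions.card_filter_midPos (hu : EvennessConditions u) (hi : letter u i ≠ .sep) :
    #{k ∈ places P u | midPos u k = midPos u i} =
      if P (letter u i) then (if (letter u i).IsPaired then 2 else 1) else 0 := by
  obtain ⟨s, hs, hletter, hcard⟩ : ∃ s : Finset ℕ, (∀ k, midPos u k = midPos u i ↔ k ∈ s) ∧
      (∀ k ∈ s, letter u k = letter u i) ∧ #s = if (letter u i).IsPaired then 2 else 1 := by
    by_cases hpaired : (letter u i).IsPaired
    · obtain ⟨j, hji, hj, hmid⟩ := hu.exists_midPos_eq_iff hpaired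
      exact ⟨{i, j}, by simpa using hmid, by simpa using hj,
        by rw [if_pos hpaired, Finset.card_pair hji.symm]⟩
    · exact ⟨{i}, fun k => by rw [hu.midPos_eq_iff_of_not_isPaired hpaired, Finset.mem_singleton],
        by simp, by simp [hpaired]⟩
  have hplaces : {k ∈ places P u | midPos u k = midPos u i} = {_k ∈ s | P (letter u i)} := by
    ext k
    simp only [Finset.mem_filter, mem_places, hs, and_comm (b := k ∈ s)]
    refine and_congr_right fun hk => ?_
    rw [hletter k hk, and_iff_right (lt_length_of_letter_ne_sep (hletter k hk ▸ hi))]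
  rw [hplaces, Finset.filter_const, apply_ite Finset.card, hcard, Finset.card_empty]

lemma EvennessConditions.degree_midPos (hu : EvennessConditions u) (hsep : .sep ∉ u) (v : ℝ) :
    #{i ∈ places Symbol.reachesTop u | (midPos u i : ℝ) = v} +
        #{i ∈ places Symbol.reachesBot u | (midPos u i : ℝ) = v} = 0 ∨
      #{i ∈ places Symbol.reachesTop u | (midPos u i : ℝ) = v} +
        #{i ∈ places Symbol.reachesBot u | (midPos u i : ℝ) = v} = 2 := by
  by_cases h : ∃ i < u.length, (midPos u i : ℝ) = v
  · obtain ⟨i, hi, rfl⟩ := h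
    have hne := letter_ne_sep hsep hi
    simp only [Nat.cast_inj, hu.card_filter_midPos hne]
    right
    cases hl : letter u i <;> simp_all [Symbol.IsPaired, Symbol.reachesBot, Symbol.reachesTop]
  · push Not at h
    have hempty (P : Symbol → Bool) : {i ∈ places P u | (midPos u i : ℝ) = v} = ∅ :=
      Finset.filter_false_of_mem fun i hi => h i (mem_places.1 hi).1
    simp [hempty]

lemma degree_countPBefore {Q : Symbol → Bool} {w : List Symbol} (h : u.countP P = w.countP Q)
    (v : ℝ) :
    #{i ∈ places P u | (u.countPBefore P i : ℝ) = v} +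
        #{i ∈ places Q w | (w.countPBefore Q i : ℝ) = v} = 0 ∨
      #{i ∈ places P u | (u.countPBefore P i : ℝ) = v} +
        #{i ∈ places Q w | (w.countPBefore Q i : ℝ) = v} = 2 := by
  rw [card_filter_countPBefore fun n : ℕ => (n : ℝ) = v,
    card_filter_countPBefore fun n : ℕ => (n : ℝ) = v, h]
  have := card_filter_eq_le_one (s := Finset.range (w.countP Q)) Nat.cast_injective.injOn v
  omega

end Places

/-! ### Strings of a word -/

section Words

variable {u v w : List Symbol} {s t : Symbol}

lemma EvennessFor.of_append_left (hw : EvennessFor t (u ++ s :: v)) (hst : s ≠ t) :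
    EvennessFor t u := by
  intro i hi heven
  have hlt : i < u.length := (List.getElem?_eq_some_iff.1 hi).1
  have hnext := hw i (by rwa [List.getElem?_append_left hlt])
    (by rwa [List.take_append_of_le_length hlt.le])
  rcases (Nat.succ_le_of_lt hlt).lt_or_eq with hlt' | hlast
  · rwa [List.getElem?_append_left hlt'] at hnext
  · rw [show i + 1 = u.length from hlast, List.getElem?_append_right le_rfl] at hnext
    exact absurd (by simpa using hnext) hst

lemma EvennessFor.of_append_right (hw : EvennessFor t (u ++ v)) (hu : Even (u.count t)) :
    EvennessFor t v := by
  intro i hi heven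
  have hget (k) : (u ++ v)[u.length + k]? = v[k]? := by
    rw [List.getElem?_append_right (by omega), add_tsub_cancel_left]
  have hcount : Even (((u ++ v).take (u.length + i)).count t) := by
    rw [List.take_length_add_append, List.count_append]
    exact hu.add heven
  simpa only [add_assoc, hget] using hw (u.length + i) ((hget i).trans hi) hcount

lemma EvennessFor.of_mem_of_intercalate {L : List (List Symbol)}
    (hL : EvennessFor t ([s].intercalate L)) (hst : s ≠ t) (hu : u ∈ L) : EvennessFor t u := by
  induction L with
  | nil => simp at hu
  | cons v L ih =>
    cases L with
    | nil => simpa [List.mem_singleton.1 hu] using hL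
    | cons v' L =>
      rw [List.intercalate_cons_cons] at hL
      have hv : EvennessFor t v := by
        rw [List.append_assoc, List.singleton_append] at hL
        exact hL.of_append_left hst
      rcases List.mem_cons.1 hu with rfl | hu
      · exact hv
      · refine ih (hL.of_append_right ?_) hu
        simpa [hst] using hv.even_count

lemma notMem_of_mem_splitOn {α : Type*} [DecidableEq α] {a : α} {l m : List α}
    (hm : m ∈ l.splitOn a) : a ∉ m := by
  induction l generalizing m with
  | nil => simp_all
  | cons x l ih =>
    rw [List.splitOn_cons_eq_if_modifyHead] at hm
    obtain ⟨k, L, hL⟩ := List.exists_cons_of_ne_nil (List.splitOn_ne_nil a l)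
    simp only [hL, List.mem_cons, beq_iff_eq, List.modifyHead_cons] at ih hm
    grind

lemma intercalate_strings (w : List Symbol) : [Symbol.sep].intercalate (strings w) = w :=
  List.intercalate_splitOn _

lemma ofFn_stringAt (w : List Symbol) :
    List.ofFn (fun k : Fin (numStrings w) => stringAt w k) = strings w :=
  List.ext_getElem (by simp [numStrings]) fun i _ hi => by simp [stringAt, hi]

lemma stringAt_of_le {k : ℕ} (hk : numStrings w ≤ k) : stringAt w k = [] :=
  List.getD_eq_default _ _ hk

lemma stringAt_mem_or_eq_nil (w : List Symbol) (k : ℕ) :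
    stringAt w k ∈ strings w ∨ stringAt w k = [] := by
  rcases lt_or_ge k (numStrings w) with hk | hk
  · rw [stringAt, List.getD_eq_getElem _ _ hk]
    exact .inl (List.getElem_mem hk)
  · exact .inr (stringAt_of_le hk)

lemma evennessConditions_nil : EvennessConditions [] := by
  constructor <;> simp [EvennessFor]

lemma EvennessConditions.stringAt (hw : EvennessConditions w) (k : ℕ) :
    EvennessConditions (stringAt w k) := by
  rcases stringAt_mem_or_eq_nil w k with hk | hk
  · rw [← intercalate_strings w] at hw
    exact ⟨hw.1.of_mem_of_intercalate (by simp) hk, hw.2.of_mem_of_intercalate (by simp) hk⟩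
  · exact hk ▸ evennessConditions_nil

lemma sep_notMem_stringAt (w : List Symbol) (k : ℕ) : .sep ∉ stringAt w k := by
  rcases stringAt_mem_or_eq_nil w k with hk | hk
  · exact notMem_of_mem_splitOn hk
  · simp [hk]

end Words

/-! ### The drawing of a word -/

/-- The strings attached to the bands `[2 z, 2 z + 2]`, all but finitely many of them empty, such
that adjacent strings have equally many strands on the common level of their bands. -/
structure BandStrings where
  str : ℤ → List Symbol
  lo : ℤ
  hi : ℤ
  band_mem : ∀ z, str z ≠ [] → lo ≤ z ∧ z < hi
  exists_ne_nil : ∃ z, str z ≠ []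
  even : ∀ z, EvennessConditions (str z)
  sep_notMem : ∀ z, .sep ∉ str z
  balance : ∀ z, (str (z + 1)).countP Symbol.reachesBot = (str z).countP Symbol.reachesTop

namespace BandStrings

/-- The strands of the layers: the layers `2 z` and `2 z + 1` are the halves of the band `z`. -/
def layerStrands (W : BandStrings) (t : ℤ) : Finset ℕ :=
  places (if Even t then Symbol.reachesBot else Symbol.reachesTop) (W.str (t / 2))

/-- The abscissas of the lower ends of the strands: a strand starts at its rank on the boundary of
a band and at its `midPos` on the critical level. -/
noncomputable def layerBot (W : BandStrings) (t : ℤ) (i : ℕ) : ℝ :=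
  if Even t then (W.str (t / 2)).countPBefore Symbol.reachesBot i else midPos (W.str (t / 2)) i

/-- The abscissas of the upper ends of the strands; see `layerBot`. -/
noncomputable def layerTop (W : BandStrings) (t : ℤ) (i : ℕ) : ℝ :=
  if Even t then midPos (W.str (t / 2)) i else (W.str (t / 2)).countPBefore Symbol.reachesTop i

variable {W : BandStrings} {z t : ℤ} {i j : ℕ}

lemma two_mul_add_one_ediv_two (z : ℤ) : (2 * z + 1) / 2 = z := by omega

lemma layerStrands_even : W.layerStrands (2 * z) = places Symbol.reachesBot (W.str z) := by
  simp [layerStrands]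

lemma layerStrands_odd : W.layerStrands (2 * z + 1) = places Symbol.reachesTop (W.str z) := by
  rw [layerStrands, if_neg (Int.not_even_two_mul_add_one z), two_mul_add_one_ediv_two]

lemma layerBot_even : W.layerBot (2 * z) i = (W.str z).countPBefore Symbol.reachesBot i := by
  simp [layerBot]

lemma layerBot_odd : W.layerBot (2 * z + 1) i = midPos (W.str z) i := by
  simp [layerBot, two_mul_add_one_ediv_two]

lemma layerTop_even : W.layerTop (2 * z) i = midPos (W.str z) i := by
  simp [layerTop]

lemma layerTop_odd : W.layerTop (2 * z + 1) i = (W.str z).countPBefore Symbol.reachesTop i := by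
  simp [layerTop, two_mul_add_one_ediv_two]

lemma layer_mem (hi : i ∈ W.layerStrands t) : 2 * W.lo ≤ t ∧ t < 2 * W.hi := by
  have hne : W.str (t / 2) ≠ [] := by
    rintro hnil
    simp [layerStrands, hnil, places] at hi
  have := W.band_mem _ hne
  omega

lemma exists_layerStrands_nonempty (W : BandStrings) : ∃ t, (W.layerStrands t).Nonempty := by
  obtain ⟨z, hz⟩ := W.exists_ne_nil
  have hlen := List.length_pos_of_ne_nil hz
  have hsep := letter_ne_sep (W.sep_notMem z) hlen
  by_cases hbot : (letter (W.str z) 0).reachesBot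
  · exact ⟨2 * z, 0, layerStrands_even ▸ mem_places.2 ⟨hlen, hbot⟩⟩
  · refine ⟨2 * z + 1, 0, layerStrands_odd ▸ mem_places.2 ⟨hlen, ?_⟩⟩
    cases hl : letter (W.str z) 0 <;> simp_all [Symbol.reachesBot, Symbol.reachesTop]

lemma layer_ordered (hi : i ∈ W.layerStrands t) (hj : j ∈ W.layerStrands t) (hij : i < j) :
    W.layerBot t i ≤ W.layerBot t j ∧ W.layerTop t i ≤ W.layerTop t j ∧
      (W.layerBot t i < W.layerBot t j ∨ W.layerTop t i < W.layerTop t j) := by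
  obtain ⟨z, rfl | rfl⟩ := t.even_or_odd'
  · simp only [layerStrands_even, layerBot_even, layerTop_even, Nat.cast_le, Nat.cast_lt] at *
    have hlt := countPBefore_lt_countPBefore hi hj hij
    exact ⟨hlt.le, midPos_mono hij.le, .inl hlt⟩
  · simp only [layerStrands_odd, layerBot_odd, layerTop_odd, Nat.cast_le, Nat.cast_lt] at *
    have hlt := countPBefore_lt_countPBefore hi hj hij
    exact ⟨midPos_mono hij.le, hlt.le, .inr hlt⟩

lemma two_mul_sub_one_eq (z : ℤ) : 2 * z - 1 = 2 * (z - 1) + 1 := by ring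

lemma layer_degree (W : BandStrings) (t : ℤ) (v : ℝ) :
    #{i ∈ W.layerStrands t | W.layerBot t i = v} +
        #{i ∈ W.layerStrands (t - 1) | W.layerTop (t - 1) i = v} = 0 ∨
      #{i ∈ W.layerStrands t | W.layerBot t i = v} +
        #{i ∈ W.layerStrands (t - 1) | W.layerTop (t - 1) i = v} = 2 := by
  obtain ⟨z, rfl | rfl⟩ := t.even_or_odd'
  · simp only [two_mul_sub_one_eq, layerStrands_even, layerStrands_odd, layerBot_even,
      layerTop_odd]
    exact degree_countPBefore (by simpa using W.balance (z - 1)) v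
  · simp only [add_sub_cancel_right, layerStrands_even, layerStrands_odd, layerBot_odd,
      layerTop_even]
    exact (W.even z).degree_midPos (W.sep_notMem z) v

/-- The drawing of the strings, with the critical levels in the middle of the bands. -/
@[simps]
noncomputable def drawing (W : BandStrings) : LayeredDrawing where
  strands := W.layerStrands
  bot := W.layerBot
  top := W.layerTop
  lo := 2 * W.lo
  hi := 2 * W.hi
  layer_mem _ _ := layer_mem
  nonempty := W.exists_layerStrands_nonempty
  ordered _ _ hi _ hj := layer_ordered hi hj
  degree := W.layer_degree

lemma isSimpleLevel_two_mul (W : BandStrings) (z : ℤ) : W.drawing.IsSimpleLevel (2 * z) := by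
  have hinj {P : Symbol → Bool} {u : List Symbol} :
      InjOn (fun i => (u.countPBefore P i : ℝ)) (places P u) :=
    Nat.cast_injective.comp_injOn injOn_countPBefore
  constructor
  · rw [drawing_strands, layerStrands_even]
    exact hinj.congr fun i _ => layerBot_even.symm
  · rw [two_mul_sub_one_eq, drawing_strands, layerStrands_odd]
    exact hinj.congr fun i _ => layerTop_odd.symm

lemma isSimpleLevel_two_mul_add_two (W : BandStrings) (z : ℤ) :
    W.drawing.IsSimpleLevel (2 * z + 1 + 1) := by
  simpa only [mul_add_one, ← one_add_one_eq_two, ← add_assoc] using W.isSimpleLevel_two_mul (z + 1)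

lemma top_eq_bot (W : BandStrings) (z : ℤ) (i : ℕ) :
    W.drawing.top (2 * z) i = W.drawing.bot (2 * z + 1) i := by
  simp only [drawing_top, drawing_bot, layerTop_even, layerBot_odd]

lemma doubleX_mid_eq (W : BandStrings) (z : ℤ) (i : ℕ) :
    W.drawing.doubleX (2 * z) i ((2 * z : ℤ) + 1) = midPos (W.str z) i := by
  rw [LayeredDrawing.doubleX_mid, drawing_top, layerTop_even]

lemma strandSet_eq_doubleSeg (hi : i < (W.str z).length) :
    strandSet (2 * z : ℤ) ((2 * z : ℤ) + 1) ((2 * z : ℤ) + 2) (letter (W.str z) i)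
      (W.drawing.doubleX (2 * z) i) = W.drawing.doubleSeg (2 * z) i := by
  refine LayeredDrawing.strandSet_doubleX (letter_ne_sep (W.sep_notMem z) hi)
    (W.top_eq_bot z i) ?_ ?_
  · rw [drawing_strands, layerStrands_even, mem_places, and_iff_right hi]
  · rw [drawing_strands, layerStrands_odd, mem_places, and_iff_right hi]

lemma lt_length_of_mem_doubleSeg {p : Plane} (hp : p ∈ W.drawing.doubleSeg (2 * z) i) :
    i < (W.str z).length := by
  rcases hp with ⟨hi, -⟩ | ⟨hi, -⟩
  · rw [drawing_strands, layerStrands_even] at hi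
    exact (mem_places.1 hi).1
  · rw [drawing_strands, layerStrands_odd] at hi
    exact (mem_places.1 hi).1

/-- The strands of the band `z` of the drawing. -/
noncomputable def strip (W : BandStrings) (z : ℤ) :
    Strip W.drawing.region (2 * z : ℤ) ((2 * z : ℤ) + 1) ((2 * z : ℤ) + 2) where
  n := (W.str z).length
  ty := letter (W.str z)
  X := W.drawing.doubleX (2 * z)
  lt_mid := by linarith
  mid_lt := by linarith
  ty_ne_sep _ := letter_ne_sep (W.sep_notMem z)
  continuous_X i := LayeredDrawing.continuous_doubleX (W.top_eq_bot z i)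
  mem_bandBoundary_iff p := by
    rw [LayeredDrawing.mem_bandBoundary_region_iff (W.isSimpleLevel_two_mul z)
      (W.isSimpleLevel_two_mul_add_two z)]
    refine exists_congr fun i => ⟨fun hp => ?_, fun ⟨hi, hp⟩ => strandSet_eq_doubleSeg hi ▸ hp⟩
    have hi := lt_length_of_mem_doubleSeg hp
    exact ⟨hi, strandSet_eq_doubleSeg hi ▸ hp⟩
  X_lt i j hij hj p hp q hq := by
    rw [strandSet_eq_doubleSeg (hij.trans hj)] at hp
    rw [strandSet_eq_doubleSeg hj] at hq
    exact LayeredDrawing.fst_lt_fst_of_mem_doubleSeg (W.isSimpleLevel_two_mul z)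
      (W.isSimpleLevel_two_mul_add_two z) hij hp hq
  X_mid_le i j hij _ := by
    rw [doubleX_mid_eq, doubleX_mid_eq]
    exact Nat.cast_le.2 (midPos_mono hij.le)
  single i _ hC k _ := by
    rw [doubleX_mid_eq, doubleX_mid_eq, Nat.cast_inj,
      (W.even z).midPos_eq_iff_of_not_isPaired (by simp [hC, Symbol.IsPaired])]
    exact id
  pair i hi hC := by
    have hsep := letter_ne_sep (W.sep_notMem z) hi
    obtain ⟨j, hji, hj, hmid⟩ := (W.even z).exists_midPos_eq_iff (i := i) (by
      cases hl : letter (W.str z) i <;> simp_all [Symbol.IsPaired])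
    refine ⟨j, lt_length_of_letter_ne_sep (hj ▸ hsep), hji, hj, fun k _ => ?_⟩
    rw [doubleX_mid_eq, doubleX_mid_eq, Nat.cast_inj, hmid]
  isUnicritical := LayeredDrawing.isUnicritical_region (W.isSimpleLevel_two_mul z)
    (W.isSimpleLevel_two_mul_add_two z)
  eq_mid _ := LayeredDrawing.eq_add_one_of_isCritical (W.isSimpleLevel_two_mul z)
    (W.isSimpleLevel_two_mul_add_two z)

lemma isCriptString (W : BandStrings) (z : ℤ) :
    IsCriptString W.drawing.region (2 * z : ℤ) ((2 * z : ℤ) + 2) (W.str z) := by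
  simpa only [strip, map_letter_range] using (W.strip z).isCriptString

end BandStrings

section Words

variable {w : List Symbol}

/-- The strings of the word `w` from the top band down, ending at the level `0`. -/
def stringAtBand (w : List Symbol) (z : ℤ) : List Symbol :=
  if z < 0 then stringAt w (-1 - z).toNat else []

lemma stringAtBand_neg (k : ℕ) : stringAtBand w (-1 - k) = stringAt w k := by
  rw [stringAtBand, if_pos (by omega), show (-1 - (-1 - k : ℤ)).toNat = k by omega]

lemma stringAtBand_of_nonneg {z : ℤ} (hz : 0 ≤ z) : stringAtBand w z = [] :=
  if_neg hz.not_gt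

lemma exists_stringAtBand_eq_stringAt_or_nil (w : List Symbol) (z : ℤ) :
    (∃ k : ℕ, stringAtBand w z = stringAt w k) ∨ stringAtBand w z = [] := by
  unfold stringAtBand
  split_ifs
  exacts [.inl ⟨_, rfl⟩, .inr rfl]

lemma band_mem_of_stringAtBand_ne_nil {z : ℤ} (hz : stringAtBand w z ≠ []) :
    -(numStrings w : ℤ) ≤ z ∧ z < 0 := by
  have hneg : z < 0 := not_le.1 (mt stringAtBand_of_nonneg hz)
  obtain ⟨k, rfl⟩ : ∃ k : ℕ, z = -1 - k := ⟨(-1 - z).toNat, by omega⟩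
  rw [stringAtBand_neg] at hz
  have hk : k < numStrings w := not_le.1 (mt stringAt_of_le hz)
  omega

lemma countP_stringAtBand_balance (hb : BoundaryConditions w) (hbal : BalanceConditions w)
    (z : ℤ) :
    (stringAtBand w (z + 1)).countP Symbol.reachesBot =
      (stringAtBand w z).countP Symbol.reachesTop := by
  obtain ⟨⟨-, hC, hD⟩, -, hlastC, hlastB⟩ := hb
  rw [countP_reachesBot, countP_reachesTop]
  rcases lt_trichotomy z (-1) with hz | rfl | hz
  · obtain ⟨k, rfl⟩ : ∃ k : ℕ, z = -1 - (k + 1 : ℕ) := ⟨(-2 - z).toNat, by omega⟩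
    rw [show (-1 - (k + 1 : ℕ) + 1 : ℤ) = -1 - k by push_cast; ring, stringAtBand_neg,
      stringAtBand_neg]
    rcases lt_trichotomy (k + 1) (numStrings w) with hk | hk | hk
    · exact hbal k hk
    · rw [stringAt_of_le hk.ge, show k = numStrings w - 1 by omega, hlastC, hlastB]
      simp
    · rw [stringAt_of_le hk.le, stringAt_of_le (by omega)]
      simp
  · rw [show (-1 + 1 : ℤ) = 0 by rfl, stringAtBand_of_nonneg le_rfl,
      show (-1 : ℤ) = -1 - (0 : ℕ) by simp, stringAtBand_neg, hC, hD]
    simp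
  · rw [stringAtBand_of_nonneg (by omega), stringAtBand_of_nonneg (by omega)]
    simp

/-- The strings of a word that satisfies the three conditions, attached to the bands below `0`. -/
@[simps]
def bandStrings (hb : BoundaryConditions w) (he : EvennessConditions w)
    (hbal : BalanceConditions w) : BandStrings where
  str := stringAtBand w
  lo := -numStrings w
  hi := 0
  band_mem _ := band_mem_of_stringAtBand_ne_nil
  exists_ne_nil := by
    refine ⟨-1 - (0 : ℕ), fun hnil => ?_⟩
    rw [stringAtBand_neg] at hnil
    simpa [hnil] using hb.1.1
  even z := by
    rcases exists_stringAtBand_eq_stringAt_or_nil w z with ⟨k, hk⟩ | hk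
    · exact hk ▸ he.stringAt k
    · exact hk ▸ evennessConditions_nil
  sep_notMem z := by
    rcases exists_stringAtBand_eq_stringAt_or_nil w z with ⟨k, hk⟩ | hk
    · exact hk ▸ sep_notMem_stringAt w k
    · simp [hk]
  balance := countP_stringAtBand_balance hb hbal

/-- The levels `0 > -2 > ⋯ > -2 m`. -/
def level (m : ℕ) (k : Fin (m + 1)) : ℝ := -2 * (k : ℕ)

lemma strictAnti_level (m : ℕ) : StrictAnti (level m) := by
  intro k l hkl
  have : ((k : ℕ) : ℝ) < (l : ℕ) := mod_cast hkl
  unfold level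
  linarith

lemma level_succ {m : ℕ} (k : Fin m) : level m k.succ = (2 * (-1 - (k : ℕ)) : ℤ) := by
  rw [level, Fin.val_succ]
  push_cast
  ring

lemma level_castSucc {m : ℕ} (k : Fin m) :
    level m k.castSucc = (2 * (-1 - (k : ℕ)) : ℤ) + 2 := by
  rw [level, Fin.val_castSucc]
  push_cast
  ring

end Words

end Cript

theorem mainTheorem2 (w : List Cript.Symbol)
    (hboundary : Cript.BoundaryConditions w)
    (hevenness : Cript.EvennessConditions w)
    (hbalance : Cript.BalanceConditions w) :
    Cript.IsCorrect w := by
  let W := Cript.bandStrings hboundary hevenness hbalance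
  have hstring (k : Fin (Cript.numStrings w)) :
      Cript.IsCriptString W.drawing.region (Cript.level _ k.succ) (Cript.level _ k.castSucc)
        (Cript.stringAt w k) := by
    rw [Cript.level_succ, Cript.level_castSucc, ← Cript.stringAtBand_neg]
    exact W.isCriptString _
  have hheight {p : Cript.Plane} (hp : p ∈ W.drawing.region) :
      Cript.level (Cript.numStrings w) (Fin.last _) ≤ p.2 ∧
        p.2 ≤ Cript.level (Cript.numStrings w) 0 := by
    simpa [Cript.level, W] using W.drawing.height_mem_Icc_of_mem_region hp
  refine ⟨W.drawing.region, W.drawing.isPlaneDomain_region, Cript.numStrings w, Cript.level _,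
    fun k => Cript.stringAt w k, ⟨Cript.strictAnti_level _, fun p => hheight,
      fun k => (hstring k).1⟩, hstring, ?_⟩
  rw [Cript.ofFn_stringAt, Cript.intercalate_strings]
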